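/- For $d\in\mathbb N$, a $d$-dimensional VASS-MDP $S=\langle Q,Q_1,Q_P,T,\tau\rangle$ consists of a finite set $Q$ of control states partitioned into $Q_1$ (states of Player 1) and $Q_P$ (probabilistic states), a finite set $T\subseteq Q\times\mathbb Z^d\times Q$ of transitions, and a function $\tau$ assigning a positive integer weight to every transition; transitions leaving states of either kind may change the counters. Configurations are pairs $(q,v)\in Q\times\mathbb N^d$. A transition $(q,z,q')\in T$ is enabled at $(q,v)$ if $v+z\ge 0$ componentwise, and then leads to $(q',v+z)$. A configuration at which no transition is enabled is a deadlock. At a non-deadlocked configuration with control state in $Q_P$, an enabled transition is taken with probability proportional to its weight; at one with control state in $Q_1$, the successor configuration is chosen by Player 1 through a strategy $\sigma$, which is a function of the whole finite play so far. A maximal play is an infinite play, or a finite play that ends in a deadlock. An initial configuration $c_0$ and a strategy $\sigma$ determine the set of maximal plays from $c_0$ that respect $\sigma$ (at probabilistic configurations, every enabled transition is allowed) and a probability measure $\mathbb P_{c_0,\sigma}$ on maximal plays. For a control state $q_F$, the reachability objective $\Diamond q_F$ is the set of maximal plays that visit a configuration with control state $q_F$, and the repeated reachability objective $\Box\Diamond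 q_F$ is the set of infinite plays that do so infinitely often. Given $S$, $c_0$, $q_F$ and an objective $A\in\{\Diamond q_F,\Box\Diamond q_F\}$, the sure problem asks whether there is a strategy $\sigma$ such that all maximal plays from $c_0$ that respect $\sigma$ belong to $A$; the almost-sure problem asks whether there is a strategy $\sigma$ with $\mathbb P_{c_0,\sigma}(A)=1$; the limit-sure problem asks whether $\sup_\sigma\mathbb P_{c_0,\sigma}(A)=1$. **Theorem.** For general VASS-MDPs (the dimension being part of the input), the sure and the almost-sure reachability problems are undecidable, and so are the limit-sure reachability problem and the sure, almost-sure and limit-sure repeated reachability problems. All six problems are undecidable already for $2$-dimensional VASS-MDPs. -/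

import Mathlib

open MeasureTheory ProbabilityTheory

/-! ### Markov decision processes, strategies, plays -/

/-- A Markov decision process on the set `C` of configurations. The configurations of Player 1
are those in `player1`, those of the probabilistic player are the others. `Step` is the transition
relation; `prob` gives the distribution of the next configuration at every probabilistic
configuration that is not a deadlock, and it charges exactly the successors. -/
structure MDP (C : Type) where
  player1 : Set C
  Step : C → C → Prop
  prob : {c : C // c ∉ player1 ∧ ∃ c', Step c c'} → PMF C
  prob_ne_zero_iff : ∀ c c', prob c c' ≠ 0 ↔ Step c.1 c'

namespace MDP

variable {C : Type} (M : MDP C)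

/-- A configuration without successors. -/
def Deadlock (c : C) : Prop := ¬ ∃ c', M.Step c c'

/-- Finite plays: nonempty finite sequences of configurations that follow the transitions. -/
def IsFinitePlay (ρ : List C) : Prop := ρ ≠ [] ∧ ρ.IsChain M.Step

/-- A (history-dependent, deterministic) strategy of Player 1: it chooses a successor after every
finite play `h ++ [c]` that ends in a configuration `c` of Player 1 that is not a deadlock. Values
of `choose` on other lists are irrelevant. -/
structure Strategy where
  choose : List C → C
  step_choose : ∀ (h : List C) (c : C), M.IsFinitePlay (h ++ [c]) → c ∈ M.player1 →
    ¬ M.Deadlock c → M.Step c (choose (h ++ [c]))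

/-- A sequence `ω : ℕ → Option C` encodes a finite or infinite play; `ω n = none` means that the
play has ended before time `n`. `history ω n` lists the configurations of `ω` at times `0, …, n`. -/
def history (ω : ℕ → Option C) (n : ℕ) : List C :=
  (List.ofFn fun i : Fin (n + 1) => ω i).reduceOption

/-- Maximal plays from `c`: infinite plays, and finite plays that end in a deadlock. -/
def IsMaximalPlayFrom (c : C) (ω : ℕ → Option C) : Prop :=
  ω 0 = some c ∧ ∀ n,
    (ω n = none ∧ ω (n + 1) = none) ∨
    (∃ a, ω n = some a ∧ M.Deadlock a ∧ ω (n + 1) = none) ∨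
    (∃ a b, ω n = some a ∧ M.Step a b ∧ ω (n + 1) = some b)

/-- The play `ω` follows the choices of `σ`. -/
def Respects {M : MDP C} (σ : M.Strategy) (ω : ℕ → Option C) : Prop :=
  ∀ n a, ω n = some a → a ∈ M.player1 → ¬ M.Deadlock a →
    ω (n + 1) = some (σ.choose (history ω n))

/-- The maximal plays from `c` that respect `σ`. -/
def plays {M : MDP C} (σ : M.Strategy) (c : C) : Set (ℕ → Option C) :=
  {ω | M.IsMaximalPlayFrom c ω ∧ Respects σ ω}

open Classical in
/-- The distribution of the next entry of the play after the configurations listed in `h`, when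
Player 1 uses `σ`: the play ends at deadlocks, Player 1 moves by `σ`, and at probabilistic
configurations the next configuration is drawn from `prob`. -/
noncomputable def next {M : MDP C} (σ : M.Strategy) (h : List C) : PMF (Option C) :=
  match h.getLast? with
  | none => PMF.pure none
  | some c =>
    if hd : ∃ c', M.Step c c' then
      if h1 : c ∈ M.player1 then PMF.pure (some (σ.choose h))
      else (M.prob ⟨c, h1, hd⟩).map some
    else PMF.pure none

instance optionMeasurableSpace : MeasurableSpace (Option C) := ⊤

instance optionDiscreteMeasurableSpace : DiscreteMeasurableSpace (Option C) := ⟨fun _ => trivial⟩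

/-- The configurations recorded by the entries of a play at times `0, …, n`. -/
def historyUpTo (n : ℕ) (x : (i : Finset.Iic n) → Option C) : List C :=
  (List.ofFn fun i : Fin (n + 1) => x ⟨i, Finset.mem_Iic.2 (Nat.lt_succ_iff.1 i.2)⟩).reduceOption

/-- `next`, as a family of Markov kernels from the past to the next entry. -/
noncomputable def nextKernel [Countable C] {M : MDP C} (σ : M.Strategy) (n : ℕ) :
    Kernel ((_ : Finset.Iic n) → Option C) (Option C) :=
  Kernel.ofFunOfCountable fun x => (next σ (historyUpTo n x)).toMeasure

instance [Countable C] {M : MDP C} (σ : M.Strategy) (n : ℕ) :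
    IsMarkovKernel (nextKernel σ n) :=
  ⟨fun x => by
    change IsProbabilityMeasure (next σ (historyUpTo n x)).toMeasure
    infer_instance⟩

/-- The law of the play that starts in `c` when Player 1 uses `σ` (Ionescu-Tulcea). -/
noncomputable def playMeasure [Countable C] {M : MDP C} (σ : M.Strategy) (c : C) :
    Measure (ℕ → Option C) :=
  Kernel.traj (X := fun _ => Option C) (fun n => nextKernel σ n) 0 (fun _ => some c)

/-- Plays that visit the set `F` of configurations. -/
def reach (F : Set C) : Set (ℕ → Option C) := {ω | ∃ n, ∃ c ∈ F, ω n = some c}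

/-- Plays (necessarily infinite) that visit the set `F` of configurations infinitely often. -/
def repeatedReach (F : Set C) : Set (ℕ → Option C) := {ω | ∀ m, ∃ n ≥ m, ∃ c ∈ F, ω n = some c}

/-- Player 1 has a strategy all of whose maximal plays from `c` satisfy the objective `A`. -/
def Surely (c : C) (A : Set (ℕ → Option C)) : Prop :=
  ∃ σ : M.Strategy, plays σ c ⊆ A

/-- Player 1 has a strategy that achieves the objective `A` from `c` with probability one. -/
def AlmostSurely [Countable C] (c : C) (A : Set (ℕ → Option C)) : Prop :=
  ∃ σ : M.Strategy, playMeasure σ c A = 1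

/-- The supremum over all strategies of the probability of the objective `A` from `c` is one. -/
def LimitSurely [Countable C] (c : C) (A : Set (ℕ → Option C)) : Prop :=
  ⨆ σ : M.Strategy, playMeasure σ c A = 1

end MDP

/-! ### VASS-MDPs -/

/-- Transitions `(q, z, q')` of a `d`-dimensional VASS with control states in `Q`. -/
abbrev VASSTransition (d : ℕ) (Q : Type) := Q × (Fin d → ℤ) × Q

/-- A `d`-dimensional VASS-MDP with control states `Q`: the control states in `Q1` belong to
Player 1, the others to the probabilistic player; `T` is the finite set of transitions, and `τ`
gives every transition a positive weight (used only at probabilistic control states). Transitions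
of either player may change the counters. -/
structure VASSMDP (d : ℕ) (Q : Type) where
  Q1 : Set Q
  T : Finset (VASSTransition d Q)
  τ : {t // t ∈ T} → ℕ+

/-- Configurations: a control state and the values of the counters. -/
abbrev VASSConfig (d : ℕ) (Q : Type) := Q × (Fin d → ℕ)

namespace VASSMDP

variable {d : ℕ} {Q : Type} (S : VASSMDP d Q)

/-- `t` is enabled at `c`: it starts in the control state of `c` and no counter gets negative. -/
def Enabled (t : VASSTransition d Q) (c : VASSConfig d Q) : Prop :=
  t.1 = c.1 ∧ ∀ i, 0 ≤ (c.2 i : ℤ) + t.2.1 i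

/-- The configuration reached from `c` by a transition `t` that is enabled at `c`. -/
def fire (t : VASSTransition d Q) (c : VASSConfig d Q) : VASSConfig d Q :=
  (t.2.2, fun i => ((c.2 i : ℤ) + t.2.1 i).toNat)

def Step (c c' : VASSConfig d Q) : Prop := ∃ t ∈ S.T, Enabled t c ∧ fire t c = c'

open Classical in
/-- The transitions of `S` that are enabled at `c`. -/
noncomputable def enabled (c : VASSConfig d Q) : Finset {t // t ∈ S.T} :=
  S.T.attach.filter fun t => Enabled t.1 c

open Classical in
/-- The probability of moving from `c` to `c'`: the sum of the weights of the enabled transitions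
that lead from `c` to `c'`, divided by the sum of the weights of all enabled transitions. -/
noncomputable def stepProb (c c' : VASSConfig d Q) : ENNReal :=
  (∑ t ∈ (S.enabled c).filter (fun t => fire t.1 c = c'), ((S.τ t : ℕ) : ENNReal)) /
    ∑ t ∈ S.enabled c, ((S.τ t : ℕ) : ENNReal)

theorem mem_enabled {c : VASSConfig d Q} {t : {t // t ∈ S.T}} :
    t ∈ S.enabled c ↔ Enabled t.1 c := by
  classical
  simp [enabled]

theorem sum_enabled_ne_zero {c : VASSConfig d Q} (h : ∃ c', S.Step c c') :
    ∑ t ∈ S.enabled c, ((S.τ t : ℕ) : ENNReal) ≠ 0 := by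
  obtain ⟨_, t, ht, he, _⟩ := h
  intro h0
  have := (Finset.sum_eq_zero_iff.1 h0) ⟨t, ht⟩ (S.mem_enabled.2 he)
  simp at this

theorem sum_enabled_ne_top (c : VASSConfig d Q) :
    ∑ t ∈ S.enabled c, ((S.τ t : ℕ) : ENNReal) ≠ ⊤ :=
  ENNReal.sum_ne_top.2 fun _ _ => ENNReal.natCast_ne_top _

theorem hasSum_stepProb {c : VASSConfig d Q} (h : ∃ c', S.Step c c') :
    HasSum (S.stepProb c) 1 := by
  classical
  have key : ∑' c', S.stepProb c c' = 1 := by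
    simp only [stepProb, div_eq_mul_inv]
    rw [ENNReal.tsum_mul_right]
    have : ∑' c', ∑ t ∈ (S.enabled c).filter (fun t => fire t.1 c = c'),
        ((S.τ t : ℕ) : ENNReal) = ∑ t ∈ S.enabled c, ((S.τ t : ℕ) : ENNReal) := by
      simp only [Finset.sum_filter]
      rw [Summable.tsum_finsetSum fun _ _ => ENNReal.summable]
      refine Finset.sum_congr rfl fun t _ => ?_
      rw [tsum_eq_single (fire t.1 c) fun b hb => if_neg (Ne.symm hb), if_pos rfl]
    rw [this]
    exact ENNReal.mul_inv_cancel (S.sum_enabled_ne_zero h) (S.sum_enabled_ne_top c)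
  exact key ▸ ENNReal.summable.hasSum

theorem stepProb_ne_zero_iff (c c' : VASSConfig d Q) : S.stepProb c c' ≠ 0 ↔ S.Step c c' := by
  classical
  rw [stepProb, Ne, ENNReal.div_eq_zero_iff, not_or]
  constructor
  · rintro ⟨h, -⟩
    obtain ⟨t, ht, -⟩ := Finset.exists_ne_zero_of_sum_ne_zero h
    rw [Finset.mem_filter, mem_enabled] at ht
    exact ⟨t.1, t.2, ht.1, ht.2⟩
  · rintro ⟨t, ht, he, hf⟩
    refine ⟨fun h0 => ?_, S.sum_enabled_ne_top c⟩
    have := (Finset.sum_eq_zero_iff.1 h0) ⟨t, ht⟩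
      (Finset.mem_filter.2 ⟨S.mem_enabled.2 he, hf⟩)
    simp at this

/-- The MDP induced by a VASS-MDP. -/
noncomputable def toMDP : MDP (VASSConfig d Q) where
  player1 := {c | c.1 ∈ S.Q1}
  Step := S.Step
  prob c := ⟨S.stepProb c.1, S.hasSum_stepProb c.2.2⟩
  prob_ne_zero_iff c c' := S.stepProb_ne_zero_iff c.1 c'

end VASSMDP

/-! ### The decision problems -/

/-- An input of the verification problems in dimension `d`: a VASS-MDP whose finite nonempty set of
control states is `{0, …, k}`, an initial configuration and a target control state. -/
structure VASSInput (d : ℕ) where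
  k : ℕ
  S : VASSMDP d (Fin (k + 1))
  init : VASSConfig d (Fin (k + 1))
  target : Fin (k + 1)

namespace VASSInput

variable {d : ℕ}

/-- The configurations whose control state is the target. -/
def targetSet (I : VASSInput d) : Set (VASSConfig d (Fin (I.k + 1))) := {c | c.1 = I.target}

def SureReachability (I : VASSInput d) : Prop :=
  I.S.toMDP.Surely I.init (MDP.reach I.targetSet)

def AlmostSureReachability (I : VASSInput d) : Prop :=
  I.S.toMDP.AlmostSurely I.init (MDP.reach I.targetSet)

def LimitSureReachability (I : VASSInput d) : Prop :=
  I.S.toMDP.LimitSurely I.init (MDP.reach I.targetSet)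

def SureRepeatedReachability (I : VASSInput d) : Prop :=
  I.S.toMDP.Surely I.init (MDP.repeatedReach I.targetSet)

def AlmostSureRepeatedReachability (I : VASSInput d) : Prop :=
  I.S.toMDP.AlmostSurely I.init (MDP.repeatedReach I.targetSet)

def LimitSureRepeatedReachability (I : VASSInput d) : Prop :=
  I.S.toMDP.LimitSurely I.init (MDP.repeatedReach I.targetSet)

end VASSInput

/-- Finite descriptions of inputs:
`(k, owners, transitions, (initial state, initial counter values), target)`, where each entry
`((q, z, q'), w)` of the list of transitions stands for the transition `(q, z, q')` with weight
`w + 1`. -/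
abbrev VASSCode :=
  ℕ × List Bool × List ((ℕ × List ℤ × ℕ) × ℕ) × (ℕ × List ℕ) × ℕ

namespace VASSCode

/-- The list of weighted transitions that is described by a list of entries, with control states
`{0, …, k}` in dimension `d`. Control states are read modulo `k + 1`, vectors are cut or padded
with zeros to length `d`. -/
def entries (d k : ℕ) (L : List ((ℕ × List ℤ × ℕ) × ℕ)) :
    List (VASSTransition d (Fin (k + 1)) × ℕ+) :=
  L.map fun e =>
    ((Fin.ofNat (k + 1) e.1.1, fun i => e.1.2.1.getD i 0, Fin.ofNat (k + 1) e.1.2.2),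
      e.2.succPNat)

/-- The total weight that a list of weighted transitions gives to `t`. -/
def totalWeight {α : Type} [DecidableEq α] (L : List (α × ℕ+)) (t : α) : ℕ :=
  ((L.filter fun e => e.1 = t).map fun e => (e.2 : ℕ)).sum

theorem totalWeight_pos {α : Type} [DecidableEq α] {L : List (α × ℕ+)} {t : α}
    (h : t ∈ (L.map Prod.fst).toFinset) : 0 < totalWeight L t := by
  simp only [List.mem_toFinset, List.mem_map] at h
  obtain ⟨e, he, rfl⟩ := h
  refine lt_of_lt_of_le e.2.pos (List.single_le_sum (fun _ _ => Nat.zero_le _) _ ?_)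
  exact List.mem_map.2 ⟨e, List.mem_filter.2 ⟨he, by simp⟩, rfl⟩

/-- The VASS-MDP given by a set of control states of Player 1 and a list of weighted transitions
(the weights of repeated transitions are added). -/
def ofList {d : ℕ} {Q : Type} [DecidableEq Q] (Q1 : Set Q) (L : List (VASSTransition d Q × ℕ+)) :
    VASSMDP d Q where
  Q1 := Q1
  T := (L.map Prod.fst).toFinset
  τ t := ⟨totalWeight L t.1, totalWeight_pos t.2⟩

/-- The input of dimension `d` that is described by a code. Every input is described by some code
(`decode_surjective`). -/
def decode (d : ℕ) : VASSCode → VASSInput d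
  | (k, owners, L, (q, v), f) =>
    { k := k
      S := ofList {q | owners.getD q false = true} (entries d k L)
      init := (Fin.ofNat (k + 1) q, fun i => v.getD i 0)
      target := Fin.ofNat (k + 1) f }

theorem decode_surjective (d : ℕ) : Function.Surjective (decode d) := by
  classical
  rintro ⟨k, ⟨Q1, T, τ⟩, ⟨q, v⟩, f⟩
  have hget : ∀ {α : Type} (a : α) {n : ℕ} (g : Fin n → α) (i : Fin n),
      (List.ofFn g).getD i a = g i := by
    intro α a n g i
    simp [List.getD_eq_getElem?_getD]
  have hof : ∀ x : Fin (k + 1), Fin.ofNat (k + 1) x = x := by simp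
  have hL : entries d k (T.attach.toList.map fun t =>
      (((t.1.1 : ℕ), List.ofFn t.1.2.1, (t.1.2.2 : ℕ)), (τ t : ℕ) - 1)) =
      T.attach.toList.map fun t => (t.1, τ t) := by
    rw [entries, List.map_map]
    refine List.map_congr_left fun t _ => ?_
    simp only [Function.comp, hof, hget]
    refine Prod.ext rfl (PNat.eq ?_)
    have := (τ t).pos
    simp only [Nat.succPNat_coe]
    omega
  refine ⟨(k, List.ofFn fun i : Fin (k + 1) => decide (i ∈ Q1),
    T.attach.toList.map fun t =>
      (((t.1.1 : ℕ), List.ofFn t.1.2.1, (t.1.2.2 : ℕ)), (τ t : ℕ) - 1),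
    ((q : ℕ), List.ofFn v), (f : ℕ)), ?_⟩
  have hS : ∀ (S S' : VASSMDP d (Fin (k + 1))), S.Q1 = S'.Q1 → ∀ hT : S.T = S'.T,
      (∀ t (h : t ∈ S.T), S.τ ⟨t, h⟩ = S'.τ ⟨t, hT ▸ h⟩) → S = S' := by
    rintro ⟨a, b, c⟩ ⟨a', b', c'⟩ h1 h2 h3
    simp only at h1 h2
    subst h1 h2
    congr 1
    exact funext fun t => h3 t.1 t.2
  simp only [decode, hof, hget, hL]
  congr 1
  refine hS _ _ ?_ ?_ ?_
  · ext x
    simp [ofList]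
  · ext x
    simp [ofList]
  · intro t h
    have ht : t ∈ T := by simpa [ofList] using h
    refine PNat.eq ?_
    change totalWeight _ t = (τ ⟨t, ht⟩ : ℕ)
    rw [totalWeight, List.filter_map, List.map_map]
    have : T.attach.toList.filter ((fun e : VASSTransition d (Fin (k + 1)) × ℕ+ =>
        decide (e.1 = t)) ∘ fun t => (t.1, τ t)) = [⟨t, ht⟩] := by
      have h1 : T.attach.toList.filter ((fun e : VASSTransition d (Fin (k + 1)) × ℕ+ =>
          decide (e.1 = t)) ∘ fun t => (t.1, τ t)) =
          T.attach.toList.filter (fun x => x = ⟨t, ht⟩) :=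
        List.filter_congr fun x _ => by simp [Subtype.ext_iff]
      rw [h1, List.filter_eq, List.count_eq_one_of_mem (Finset.nodup_toList _) (by simp)]
      rfl
    rw [this]
    simp

end VASSCode

/-- The decision problem `P` for VASS-MDPs of dimension `d` is undecidable. -/
def UndecidableInDim (d : ℕ) (P : VASSInput d → Prop) : Prop :=
  ¬ ComputablePred fun c : VASSCode => P (VASSCode.decode d c)

/-- The decision problem `P` for VASS-MDPs of arbitrary dimension, where the dimension is a part of
the input, is undecidable. -/
def UndecidableVASSProblem (P : ∀ d, VASSInput d → Prop) : Prop :=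
  ¬ ComputablePred fun x : ℕ × VASSCode => P x.1 (VASSCode.decode x.1 x.2)

/-! Sure repeated reachability is the strongest of the six properties and limit-sure reachability
the weakest. So one reduction with a gap settles all of them: from a program, build a 2-dimensional
VASS-MDP that satisfies the strongest property if the program halts and violates the weakest if it
does not.

Player 1 simulates a two-counter program. The only thing a VASS cannot do is test a counter for
zero. Player 1 therefore merely claims that counter `i` is zero by moving to a probabilistic state.
From there one transition continues the simulation, and another decrements counter `i` and enters a
losing deadlock. If the claim is true, the decrement is disabled and the opponent has no choice. If
it is false, the play is lost with probability at least `δ`, where `δ` is the inverse of the number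
of transitions and hence does not depend on the counters.

If the program halts, Player 1 follows a halting computation and then uses the self-loop at the
target; every check on the way is harmless (`CounterGraph.surely_of_reflTransGen`). If it does not
halt, the target is reached only after some false claim, and the first one already bounds the
probability of winning by `1 - δ`, uniformly in the strategy (`MDP.playMeasure_reach_le`,
`CounterGraph.exists_reflTransGen_of_limitSurely`).

The power of two counters is Minsky's theorem. Partial recursive functions are computed by register
programs (`RegComputable.of_partrec'`), registers are packed into one Gödel number on which a second
counter permits multiplication and division (`IsRegisterRel.exists_counterImpl`), and the resulting
structured program is unfolded into a finite graph (`IsCounterRel.exists_graph`). Nondeterminism in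
the programs is harmless, since Player 1 resolves it. One graph serves all inputs `n`, which enter
only through the initial counter value `2 ^ n`, so the reduction is evidently computable. -/

namespace MDP

variable {C : Type} {M : MDP C}

/-! ### Histories, plays and exit times -/

theorem history_zero (ω : ℕ → Option C) : history ω 0 = (ω 0).toList := by
  cases h : ω 0 <;> simp [history, h, List.reduceOption]

theorem history_succ (ω : ℕ → Option C) (n : ℕ) :
    history ω (n + 1) = history ω n ++ (ω (n + 1)).toList := by
  have : (List.ofFn fun i : Fin (n + 1 + 1) => ω i) =
      (List.ofFn fun i : Fin (n + 1) => ω i) ++ [ω (n + 1)] := by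
    rw [List.ofFn_succ']
    simp
  rw [history, this, List.reduceOption_append, history]
  cases h : ω (n + 1) <;> simp [List.reduceOption]

theorem history_eq_historyUpTo (ω : ℕ → Option C) (n : ℕ) :
    history ω n = historyUpTo n (Preorder.frestrictLe n ω) := rfl

theorem next_append_of_deadlock (σ : M.Strategy) (h : List C) {a : C} (ha : M.Deadlock a) :
    next σ (h ++ [a]) = PMF.pure none := by
  simp only [next, List.getLast?_append, List.getLast?_singleton, Option.some_or]
  rw [dif_neg ha]

theorem next_append_of_player1 (σ : M.Strategy) (h : List C) {a : C} (ha : ¬ M.Deadlock a)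
    (h1 : a ∈ M.player1) : next σ (h ++ [a]) = PMF.pure (some (σ.choose (h ++ [a]))) := by
  simp only [next, List.getLast?_append, List.getLast?_singleton, Option.some_or]
  rw [dif_pos (not_not.1 ha), dif_pos h1]

theorem next_append_of_not_player1 (σ : M.Strategy) (h : List C) {a : C}
    (ha : a ∉ M.player1 ∧ ∃ c', M.Step a c') :
    next σ (h ++ [a]) = (M.prob ⟨a, ha⟩).map some := by
  simp only [next, List.getLast?_append, List.getLast?_singleton, Option.some_or]
  rw [dif_pos ha.2, dif_neg ha.1]

/-- A sequence whose entries are all in the support of the distribution given by the past is a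
maximal play that respects the strategy. -/
theorem mem_plays_of_mem_support (σ : M.Strategy) {c : C} {ω : ℕ → Option C} (h0 : ω 0 = some c)
    (hω : ∀ n, ω (n + 1) ∈ (next σ (history ω n)).support) : ω ∈ plays σ c := by
  have key : ∀ n h a, history ω n = h ++ [a] → M.IsFinitePlay (h ++ [a]) →
      (M.Deadlock a ∧ ω (n + 1) = none) ∨ ∃ b, M.Step a b ∧ ω (n + 1) = some b ∧
        (a ∈ M.player1 → b = σ.choose (h ++ [a])) := by
    intro n h a hh hp
    have := hω n
    rw [hh] at this
    by_cases hd : M.Deadlock a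
    · rw [next_append_of_deadlock σ h hd] at this
      left
      simpa [hd] using this
    · right
      by_cases h1 : a ∈ M.player1
      · rw [next_append_of_player1 σ h hd h1] at this
        exact ⟨_, σ.step_choose h a hp h1 hd, by simpa using this, fun _ => rfl⟩
      · rw [next_append_of_not_player1 σ h ⟨h1, not_not.1 hd⟩] at this
        obtain ⟨b, hb, hb'⟩ := (PMF.mem_support_map_iff _ _ _).1 this
        exact ⟨b, (M.prob_ne_zero_iff _ _).1 hb, hb'.symm, fun h => absurd h h1⟩
  -- `history` drops the entries `none`, so after the end of the play it still lists the whole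
  -- finite play. This is why the last configuration `a` may be a deadlock while `ω n = none`.
  have inv : ∀ n, ∃ h a, history ω n = h ++ [a] ∧ M.IsFinitePlay (h ++ [a]) ∧
      (ω n = some a ∨ ω n = none ∧ M.Deadlock a) := by
    intro n
    induction n with
    | zero => exact ⟨[], c, by simp [history_zero, h0], by simp [IsFinitePlay], Or.inl h0⟩
    | succ n ih =>
      obtain ⟨h, a, hh, hp, -⟩ := ih
      rcases key n h a hh hp with ⟨hd, hn⟩ | ⟨b, hs, hn, -⟩
      · exact ⟨h, a, by simp [history_succ, hn, hh], hp, Or.inr ⟨hn, hd⟩⟩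
      · refine ⟨h ++ [a], b, by simp [history_succ, hn, hh], ⟨by simp, ?_⟩, Or.inl hn⟩
        rw [List.isChain_append]
        refine ⟨hp.2, by simp, ?_⟩
        simpa using hs
  refine ⟨⟨h0, fun n => ?_⟩, fun n a ha h1 hd => ?_⟩
  · obtain ⟨h, a, hh, hp, hn⟩ := inv n
    rcases key n h a hh hp with ⟨hd, hs⟩ | ⟨b, hs, hb, -⟩
    · rcases hn with hn | hn
      · exact Or.inr (Or.inl ⟨a, hn, hd, hs⟩)
      · exact Or.inl ⟨hn.1, hs⟩
    · rcases hn with hn | hn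
      · exact Or.inr (Or.inr ⟨a, b, hn, hs, hb⟩)
      · exact absurd ⟨b, hs⟩ hn.2
  · obtain ⟨h, a', hh, hp, hn⟩ := inv n
    rcases hn with hn | hn
    · obtain rfl : a' = a := by simpa [hn] using ha
      rcases key n h a' hh hp with ⟨hd', -⟩ | ⟨b, -, hb, hb'⟩
      · exact absurd hd' hd
      · rw [hb, hh, hb' h1]
    · simp [hn.1] at ha

theorem repeatedReach_subset_reach (F : Set C) : repeatedReach F ⊆ reach F := fun _ h =>
  let ⟨n, _, h⟩ := h 0
  ⟨n, h⟩

theorem Surely.mono {c : C} {A B : Set (ℕ → Option C)} (hAB : A ⊆ B)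
    (h : M.Surely c A) : M.Surely c B := by
  obtain ⟨σ, hσ⟩ := h
  exact ⟨σ, hσ.trans hAB⟩

/-- The plays that stay in `good` before time `n` and are in `bad` at time `n`. -/
def leaveAt (good bad : Set C) (n : ℕ) : Set (ℕ → Option C) :=
  {ω | (∀ i < n, ∃ a ∈ good, ω i = some a) ∧ ∃ a ∈ bad, ω n = some a}

theorem pairwise_disjoint_leaveAt {good bad : Set C} (h : Disjoint good bad) :
    Pairwise (Function.onFun Disjoint (leaveAt good bad)) := by
  have key : ∀ i j, i < j → Disjoint (leaveAt good bad i) (leaveAt good bad j) := by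
    intro i j hij
    refine Set.disjoint_left.2 fun ω hi hj => ?_
    obtain ⟨a, ha, ha'⟩ := hj.1 i hij
    obtain ⟨b, hb, hb'⟩ := hi.2
    obtain rfl : a = b := by simpa [ha'] using hb'
    exact Set.disjoint_left.1 h ha hb
  intro i j hij
  rcases lt_or_gt_of_ne hij with h | h
  · exact key i j h
  · exact (key j i h).symm

/-- The prefixes up to time `n` of the plays in `leaveAt good bad n`. -/
def leaveAtPrefix (good bad : Set C) (n : ℕ) : Set ((_ : Finset.Iic n) → Option C) :=
  {x | (∀ i (h : i < n), ∃ a ∈ good, x ⟨i, Finset.mem_Iic.2 h.le⟩ = some a) ∧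
    ∃ a ∈ bad, x ⟨n, Finset.mem_Iic.2 le_rfl⟩ = some a}

/-- The event depends only on the entries up to time `n`; this gives measurability and allows
conditioning on the past before the next move. -/
theorem leaveAt_eq_preimage (good bad : Set C) (n : ℕ) :
    leaveAt good bad n =
      Preorder.frestrictLe (π := fun _ => Option C) n ⁻¹' leaveAtPrefix good bad n := rfl

theorem historyUpTo_of_mem_leaveAtPrefix {good bad : Set C} {n : ℕ}
    {x : (_ : Finset.Iic n) → Option C} (hx : x ∈ leaveAtPrefix good bad n) :
    ∃ h, ∃ a ∈ bad, historyUpTo n x = h ++ [a] := by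
  obtain ⟨-, a, ha, hx⟩ := hx
  -- Extending the prefix to a full sequence makes the recursion for `history` available.
  let ω : ℕ → Option C := fun i => if h : i ≤ n then x ⟨i, Finset.mem_Iic.2 h⟩ else none
  have hω : historyUpTo n x = history ω n := by
    rw [history_eq_historyUpTo]
    congr 1
    ext1 i
    simp [ω, Preorder.frestrictLe, Finset.mem_Iic.1 i.2]
  have hn : ω n = some a := by simp [ω, hx]
  rw [hω]
  cases n with
  | zero => exact ⟨[], a, ha, by simp [history_zero, hn]⟩
  | succ n => exact ⟨_, a, ha, by rw [history_succ, hn]; rfl⟩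

/-! ### The law of the play -/

section Measure

variable [Countable C]

instance (σ : M.Strategy) (c : C) : IsProbabilityMeasure (playMeasure σ c) := by
  unfold playMeasure
  infer_instance

/-- Disintegration of the law along one step. It reduces statements about the next entry to
pointwise statements about `next`, integrated over the past. -/
theorem map_playMeasure (σ : M.Strategy) (c : C) (n : ℕ) :
    (playMeasure σ c).map (fun ω => (Preorder.frestrictLe (π := fun _ => Option C) n ω, ω (n + 1)))
      = ((playMeasure σ c).map (Preorder.frestrictLe (π := fun _ => Option C) n)) ⊗ₘ
        nextKernel σ n := by
  unfold playMeasure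
  rw [Kernel.traj_map_frestrictLe_apply]
  exact (Kernel.partialTraj_compProd_eq_map_traj (X := fun _ => Option C) (Nat.zero_le n)).symm

theorem ae_zero_playMeasure (σ : M.Strategy) (c : C) :
    ∀ᵐ ω ∂(playMeasure σ c), ω 0 = some c := by
  have h := Kernel.traj_map_frestrictLe_apply (X := fun _ => Option C)
    (κ := fun n => nextKernel σ n) 0 0 (fun _ => some c)
  have h2 : ∀ᵐ x ∂((playMeasure σ c).map (Preorder.frestrictLe (π := fun _ => Option C) 0)),
      x ⟨0, by simp⟩ = some c := by
    unfold playMeasure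
    rw [h, Kernel.partialTraj_self, Kernel.id_apply, ae_dirac_eq]
    simp
  exact ae_of_ae_map (by fun_prop) h2

theorem ae_mem_support_playMeasure (σ : M.Strategy) (c : C) (n : ℕ) :
    ∀ᵐ ω ∂(playMeasure σ c), ω (n + 1) ∈ (next σ (history ω n)).support := by
  have h2 : ∀ᵐ p ∂((playMeasure σ c).map (fun ω =>
      (Preorder.frestrictLe (π := fun _ => Option C) n ω, ω (n + 1)))),
      p.2 ∈ (next σ (historyUpTo n p.1)).support := by
    rw [map_playMeasure]
    refine Measure.ae_compProd_of_ae_ae (.of_discrete) (ae_of_all _ fun x => ?_)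
    change ∀ᵐ y ∂((next σ (historyUpTo n x)).toMeasure), y ∈ (next σ (historyUpTo n x)).support
    rw [ae_iff]
    change (next σ (historyUpTo n x)).toMeasure ((next σ (historyUpTo n x)).support)ᶜ = 0
    rw [PMF.toMeasure_apply_eq_zero_iff _ (.of_discrete)]
    exact disjoint_compl_right
  exact ae_of_ae_map (by fun_prop) h2

/-- Bridge between the two semantics: it turns sure winning into almost-sure winning and lets path
arguments bound probabilities. -/
theorem ae_mem_plays (σ : M.Strategy) (c : C) : ∀ᵐ ω ∂(playMeasure σ c), ω ∈ plays σ c := by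
  filter_upwards [ae_zero_playMeasure σ c, ae_all_iff.2 (ae_mem_support_playMeasure σ c)]
    with ω h0 h using mem_plays_of_mem_support σ h0 h

theorem Surely.almostSurely {c : C} {A : Set (ℕ → Option C)} (h : M.Surely c A) :
    M.AlmostSurely c A := by
  obtain ⟨σ, hσ⟩ := h
  refine ⟨σ, le_antisymm prob_le_one ?_⟩
  calc (1 : ENNReal) = playMeasure σ c Set.univ := measure_univ.symm
    -- Almost-everywhere monotonicity holds for arbitrary sets, so `A` need not be measurable.
    _ ≤ playMeasure σ c A := measure_mono_ae <| by
      filter_upwards [ae_mem_plays σ c] with ω hω _ using hσ hω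

theorem AlmostSurely.limitSurely {c : C} {A : Set (ℕ → Option C)} (h : M.AlmostSurely c A) :
    M.LimitSurely c A := by
  obtain ⟨σ, hσ⟩ := h
  exact le_antisymm (iSup_le fun _ => prob_le_one) (hσ ▸ le_iSup (fun σ => playMeasure σ c A) σ)

theorem LimitSurely.mono {c : C} {A B : Set (ℕ → Option C)} (hAB : A ⊆ B)
    (h : M.LimitSurely c A) : M.LimitSurely c B :=
  le_antisymm (iSup_le fun _ => prob_le_one)
    (h.symm.le.trans (iSup_mono fun _ => measure_mono hAB))

theorem measurableSet_leaveAt (good bad : Set C) (n : ℕ) :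
    MeasurableSet (leaveAt good bad n) := by
  rw [leaveAt_eq_preimage]
  exact (MeasurableSet.of_discrete (s := leaveAtPrefix good bad n)).preimage (by fun_prop)

/-- Whatever the past, a configuration in `bad` belongs to the probabilistic player, so the strategy
cannot influence the next move and the trap is avoided with probability at most `1 - δ`. Integrating
over the pasts that exit at time `n` gives the bound. -/
theorem playMeasure_leaveAt_inter_le {bad trap : Set C} (good : Set C) {δ : ENNReal}
    (hbad : ∀ b ∈ bad, ∃ (hb : b ∉ M.player1 ∧ ∃ c', M.Step b c'), ∃ t ∈ trap,
      δ ≤ M.prob ⟨b, hb⟩ t) (σ : M.Strategy) (c : C) (n : ℕ) :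
    playMeasure σ c (leaveAt good bad n ∩ {ω | ω (n + 1) ∉ some '' trap}) ≤
      (1 - δ) * playMeasure σ c (leaveAt good bad n) := by
  set μ := playMeasure σ c
  have h1 : leaveAt good bad n ∩ {ω | ω (n + 1) ∉ some '' trap} =
      (fun ω => (Preorder.frestrictLe (π := fun _ => Option C) n ω, ω (n + 1))) ⁻¹'
        (leaveAtPrefix good bad n ×ˢ (some '' trap)ᶜ) := rfl
  rw [h1, ← Measure.map_apply (by fun_prop) (.of_discrete), map_playMeasure,
    Measure.compProd_apply_prod (.of_discrete) (.of_discrete), leaveAt_eq_preimage,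
    ← Measure.map_apply (by fun_prop) (.of_discrete), ← setLIntegral_const]
  refine setLIntegral_mono (by fun_prop) fun x hx => ?_
  change (next σ (historyUpTo n x)).toMeasure (some '' trap)ᶜ ≤ 1 - δ
  rw [prob_compl_eq_one_sub (.of_discrete)]
  refine tsub_le_tsub_left ?_ 1
  obtain ⟨h, b, hb, hh⟩ := historyUpTo_of_mem_leaveAtPrefix hx
  obtain ⟨hb', t, ht, hδ⟩ := hbad b hb
  rw [hh, next_append_of_not_player1 σ h hb']
  calc δ ≤ M.prob ⟨b, hb'⟩ t := hδ
    _ ≤ (M.prob ⟨b, hb'⟩).map some (some t) := by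
      rw [PMF.map_apply]
      refine le_of_eq_of_le ?_ (ENNReal.le_tsum t)
      simp
    _ = ((M.prob ⟨b, hb'⟩).map some).toMeasure {some t} :=
      (PMF.toMeasure_apply_singleton _ _ (.of_discrete)).symm
    _ ≤ _ := measure_mono (by simpa using ht)

/-- If plays can leave `good` only for `bad`, where the next configuration is a losing deadlock with
probability at least `δ`, then `F` is reached with probability at most `1 - δ`. -/
theorem playMeasure_reach_le {good bad trap F : Set C} {δ : ENNReal}
    (hgood : ∀ a ∈ good, ∀ b, M.Step a b → b ∈ good ∪ bad)
    (hbad : ∀ b ∈ bad, ∃ (hb : b ∉ M.player1 ∧ ∃ c', M.Step b c'), ∃ t ∈ trap,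
      δ ≤ M.prob ⟨b, hb⟩ t)
    (htrap : ∀ t ∈ trap, M.Deadlock t) (hgb : Disjoint good bad)
    (hgF : Disjoint good F) (hbF : Disjoint bad F) (htF : Disjoint trap F)
    (σ : M.Strategy) {c : C} (hc : c ∈ good) :
    playMeasure σ c (reach F) ≤ 1 - δ := by
  set μ := playMeasure σ c
  -- A play that reaches `F` has a first time outside `good`, where it must be in `bad`. The next
  -- entry cannot be a trap, because traps are deadlocks outside `F` and `F` has not been visited
  -- yet.
  have hsub : reach F ≤ᵐ[μ] ⋃ n, leaveAt good bad n ∩ {ω | ω (n + 1) ∉ some '' trap} := by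
    filter_upwards [ae_mem_plays σ c] with ω hω hr
    obtain ⟨⟨h0, hstep⟩, -⟩ := hω
    obtain ⟨N, f, hf, hN⟩ := hr
    have hnone : ∀ k n, ω n = none → ω (n + k) = none := by
      intro k n hn
      induction k with
      | zero => exact hn
      | succ k ih =>
        rcases hstep (n + k) with h | ⟨a, h, -⟩ | ⟨a, b, h, -⟩
        · exact h.2
        · simp [ih] at h
        · simp [ih] at h
    have hex : ∃ n, ¬ ∃ a ∈ good, ω n = some a := by
      refine ⟨N, ?_⟩
      rintro ⟨a, ha, ha'⟩
      obtain rfl : f = a := by simpa [hN] using ha'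
      exact Set.disjoint_left.1 hgF ha hf
    classical
    obtain ⟨n, hn, hmin⟩ : ∃ n, (¬ ∃ a ∈ good, ω n = some a) ∧
        ∀ i < n, ∃ a ∈ good, ω i = some a :=
      ⟨Nat.find hex, Nat.find_spec hex, fun i hi => not_not.1 (Nat.find_min hex hi)⟩
    have hnN : n ≤ N := by
      by_contra! h
      obtain ⟨a, ha, ha'⟩ := hmin N h
      obtain rfl : f = a := by simpa [hN] using ha'
      exact Set.disjoint_left.1 hgF ha hf
    have hnb : ∃ a ∈ bad, ω n = some a := by
      cases n with
      | zero => exact absurd ⟨c, hc, h0⟩ hn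
      | succ n =>
        obtain ⟨a, ha, ha'⟩ := hmin n (Nat.lt_succ_self n)
        rcases hstep n with h | ⟨b, h, -, h'⟩ | ⟨a', b, h, hs, h'⟩
        · simp [ha'] at h
        · have := hnone (N - (n + 1)) (n + 1) h'
          rw [Nat.add_sub_cancel' hnN, hN] at this
          simp at this
        · obtain rfl : a = a' := by simpa [ha'] using h
          rcases hgood a ha b hs with hb | hb
          · exact absurd ⟨b, hb, h'⟩ hn
          · exact ⟨b, hb, h'⟩
    refine Set.mem_iUnion.2 ⟨n, ⟨hmin, hnb⟩, ?_⟩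
    rintro ⟨t, ht, ht'⟩
    obtain ⟨b, hb, hb'⟩ := hnb
    have h2 : ω (n + 2) = none := by
      rcases hstep (n + 1) with h | ⟨_, -, -, h⟩ | ⟨a', b', h, hs, -⟩
      · exact h.2
      · exact h
      · obtain rfl : t = a' := by simpa [← ht'] using h
        exact absurd ⟨_, hs⟩ (htrap t ht)
    obtain rfl | rfl | h : N = n ∨ N = n + 1 ∨ n + 2 ≤ N := by omega
    · obtain rfl : f = b := by simpa [hN] using hb'
      exact Set.disjoint_left.1 hbF hb hf
    · obtain rfl : t = f := by simpa [hN] using ht'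
      exact Set.disjoint_left.1 htF ht hf
    · have := hnone (N - (n + 2)) (n + 2) h2
      rw [Nat.add_sub_cancel' h, hN] at this
      simp at this
  -- Only the first exit is charged. Exits at different times are disjoint events, so their
  -- probabilities sum to at most one and the factor `1 - δ` survives.
  calc μ (reach F) ≤ μ (⋃ n, leaveAt good bad n ∩ {ω | ω (n + 1) ∉ some '' trap}) :=
        measure_mono_ae hsub
    _ ≤ ∑' n, μ (leaveAt good bad n ∩ {ω | ω (n + 1) ∉ some '' trap}) := measure_iUnion_le _
    _ ≤ ∑' n, (1 - δ) * μ (leaveAt good bad n) :=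
        ENNReal.tsum_le_tsum fun n => playMeasure_leaveAt_inter_le good hbad σ c n
    _ = (1 - δ) * μ (⋃ n, leaveAt good bad n) := by
        rw [ENNReal.tsum_mul_left, measure_iUnion (pairwise_disjoint_leaveAt hgb)
          (measurableSet_leaveAt good bad)]
    _ ≤ 1 - δ := mul_le_of_le_one_right' prob_le_one

end Measure

/-- If Player 1 can follow an infinite path along which the other player never has a choice, then
the play along this path is the only one that respects some strategy. -/
theorem exists_strategy_plays_subset (w : ℕ → C) (hw : ∀ n, M.Step (w n) (w (n + 1)))
    (hdet : ∀ n, w n ∉ M.player1 → ∀ b, M.Step (w n) b → b = w (n + 1)) :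
    ∃ σ : M.Strategy, plays σ (w 0) ⊆ {fun n => some (w n)} := by
  classical
  -- The length of the history tells the time. If the last configuration agrees with `w` at that
  -- time, the strategy moves along `w`; elsewhere it takes any successor, with `w 0` as a dummy
  -- value when there is none.
  let ch : List C → C := fun h =>
    if h.getLast? = some (w (h.length - 1)) then w h.length
    else if hd : ∃ b a, h.getLast? = some a ∧ M.Step a b then hd.choose else w 0
  refine ⟨⟨ch, fun h a hp h1 hd => ?_⟩, ?_⟩
  · simp only [ch, List.getLast?_append, List.getLast?_singleton, Option.some_or,
      List.length_append, List.length_singleton, Nat.add_sub_cancel]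
    split_ifs with h2 h3
    · obtain rfl : a = w h.length := by simpa using h2
      exact hw _
    · obtain ⟨a', h4, h5⟩ := h3.choose_spec
      obtain rfl : a = a' := by simpa using h4
      exact h5
    · obtain ⟨b, hb⟩ := not_not.1 hd
      exact absurd ⟨b, a, rfl, hb⟩ h3
  · rintro ω ⟨⟨h0, hstep⟩, hr⟩
    have key : ∀ n, history ω n = (List.ofFn fun i : Fin (n + 1) => w i) ∧ ω n = some (w n) := by
      intro n
      induction n with
      | zero => exact ⟨by simp [history_zero, h0], h0⟩
      | succ n ih =>
        suffices h : ω (n + 1) = some (w (n + 1)) by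
          refine ⟨?_, h⟩
          rw [history_succ, h, ih.1, List.ofFn_succ' (n := n + 1)]
          simp
        by_cases h1 : w n ∈ M.player1
        · rw [hr n (w n) ih.2 h1 (not_not.2 ⟨_, hw n⟩), ih.1]
          simp only [ch]
          rw [if_pos]
          · simp
          · rw [List.ofFn_succ']
            simp
        · rcases hstep n with h | ⟨a, h, hd, -⟩ | ⟨a, b, h, hs, hb⟩
          · simp [ih.2] at h
          · obtain rfl : w n = a := by simpa [ih.2] using h
            exact absurd ⟨_, hw n⟩ hd
          · obtain rfl : w n = a := by simpa [ih.2] using h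
            rw [hb, hdet n h1 b hs]
    exact funext fun n => (key n).2

end MDP

/-! ### Register programs -/

open Function in
/-- Relations on register contents that are defined by nondeterministic programs built from
increments, decrements and zero tests by composition and iteration. -/
inductive IsRegisterRel : ((ℕ → ℕ) → (ℕ → ℕ) → Prop) → Prop
  | skip : IsRegisterRel Eq
  | inc (i : ℕ) : IsRegisterRel fun x y => y = update x i (x i + 1)
  | dec (i : ℕ) : IsRegisterRel fun x y => x i ≠ 0 ∧ y = update x i (x i - 1)
  | test (i : ℕ) : IsRegisterRel fun x y => x i = 0 ∧ y = x
  | comp {R S} : IsRegisterRel R → IsRegisterRel S → IsRegisterRel (Relation.Comp R S)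
  | star {R} : IsRegisterRel R → IsRegisterRel (Relation.ReflTransGen R)

/-- Some register program behaves as the relation `F` on the states that satisfy `p`. -/
def RegImpl (p : (ℕ → ℕ) → Prop) (F : (ℕ → ℕ) → (ℕ → ℕ) → Prop) : Prop :=
  ∃ R, IsRegisterRel R ∧ ∀ x, p x → ∀ y, R x y ↔ F x y

/-- Some register program behaves as the function `f` on the states that satisfy `p`. -/
def RegFun (p : (ℕ → ℕ) → Prop) (f : (ℕ → ℕ) → ℕ → ℕ) : Prop :=
  RegImpl p fun x y => y = f x

/-! ### Combinators for register programs -/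

namespace RegImpl

open Function

variable {p q : (ℕ → ℕ) → Prop} {F G : (ℕ → ℕ) → (ℕ → ℕ) → Prop}

theorem of_rel {R : (ℕ → ℕ) → (ℕ → ℕ) → Prop} (h : IsRegisterRel R) : RegImpl p R :=
  ⟨R, h, fun _ _ _ => Iff.rfl⟩

theorem congr (h : RegImpl p F) (hp : ∀ x, q x → p x)
    (hFG : ∀ x, q x → ∀ y, F x y ↔ G x y) : RegImpl q G := by
  obtain ⟨R, hR, h⟩ := h
  exact ⟨R, hR, fun x hx y => (h x (hp x hx) y).trans (hFG x hx y)⟩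

theorem comp (h1 : RegImpl p F) (h2 : RegImpl q G) (h : ∀ x, p x → ∀ y, F x y → q y) :
    RegImpl p (Relation.Comp F G) := by
  obtain ⟨R, hR, h1⟩ := h1
  obtain ⟨S, hS, h2⟩ := h2
  refine ⟨_, hR.comp hS, fun x hx y => exists_congr fun z => ?_⟩
  rw [h1 x hx]
  exact and_congr_right fun hz => h2 z (h x hx z hz) y

theorem star (h1 : RegImpl p F) (h : ∀ x, p x → ∀ y, F x y → p y) :
    RegImpl p (Relation.ReflTransGen F) := by
  obtain ⟨R, hR, h1⟩ := h1
  refine ⟨_, hR.star, fun x hx y => ⟨fun hr => ?_, fun hr => ?_⟩⟩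
  · suffices Relation.ReflTransGen F x y ∧ p y from this.1
    induction hr with
    | refl => exact ⟨.refl, hx⟩
    | tail _ hs ih =>
      have := (h1 _ ih.2 _).1 hs
      exact ⟨ih.1.tail this, h _ ih.2 _ this⟩
  · suffices Relation.ReflTransGen R x y ∧ p y from this.1
    induction hr with
    | refl => exact ⟨.refl, hx⟩
    | tail _ hs ih => exact ⟨ih.1.tail ((h1 _ ih.2 _).2 hs), h _ ih.2 _ hs⟩

end RegImpl

namespace RegFun

open Function

variable {p q : (ℕ → ℕ) → Prop} {f g : (ℕ → ℕ) → ℕ → ℕ}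

theorem congr (h : RegFun p f) (hp : ∀ x, q x → p x) (hfg : ∀ x, q x → f x = g x) :
    RegFun q g :=
  RegImpl.congr h hp fun x hx _ => by rw [hfg x hx]

theorem mono (h : RegFun p f) (hp : ∀ x, q x → p x) : RegFun q f :=
  h.congr hp fun _ _ => rfl

theorem comp (h1 : RegFun p f) (h2 : RegFun q g) (h : ∀ x, p x → q (f x)) :
    RegFun p fun x => g (f x) :=
  (RegImpl.comp h1 h2 fun x hx y hy => hy ▸ h x hx).congr (fun _ => id) fun _ _ _ => by
    simp [Relation.Comp]

theorem skip : RegFun p fun x => x :=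
  (RegImpl.of_rel .skip).congr (fun _ => id) fun _ _ _ => eq_comm

theorem inc (i : ℕ) : RegFun p fun x => update x i (x i + 1) := RegImpl.of_rel (.inc i)

/-- Iteration of a program as long as register `c` can be decremented. -/
theorem loop {F : (ℕ → ℕ) → ℕ → ℕ} (c : ℕ) (hg : RegFun q g)
    (h0 : ∀ x, p x → x c = 0 → F x = x)
    (h1 : ∀ x, p x → x c ≠ 0 → q (update x c (x c - 1)) ∧ p (g (update x c (x c - 1))) ∧
      g (update x c (x c - 1)) c = x c - 1 ∧ F (g (update x c (x c - 1))) = F x) :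
    RegFun p F := by
  obtain ⟨R, hR, hg⟩ := hg
  -- The closing zero test discards every run that leaves the iteration early, which makes the
  -- nondeterministic star behave as a while loop. `F` is a loop invariant, and the value of `c` is
  -- the induction parameter.
  refine ⟨_, ((IsRegisterRel.dec c).comp hR).star.comp (.test c), fun x hx y => ?_⟩
  obtain ⟨k, hk⟩ : ∃ k, x c = k := ⟨_, rfl⟩
  have hstep : ∀ x, p x → ∀ z, Relation.Comp (fun x y => x c ≠ 0 ∧ y = update x c (x c - 1)) R x z
      ↔ x c ≠ 0 ∧ z = g (update x c (x c - 1)) := by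
    intro x hx z
    constructor
    · rintro ⟨w, ⟨hw, rfl⟩, hR⟩
      exact ⟨hw, (hg _ (h1 x hx hw).1 _).1 hR⟩
    · rintro ⟨hw, hz⟩
      exact ⟨_, ⟨hw, rfl⟩, (hg _ (h1 x hx hw).1 _).2 hz⟩
  induction k generalizing x with
  | zero =>
    change _ ↔ y = F x
    rw [h0 x hx hk]
    constructor
    · rintro ⟨z, hz, hz0, rfl⟩
      rcases Relation.ReflTransGen.cases_head hz with rfl | ⟨w, hw, -⟩
      · rfl
      · exact absurd hk ((hstep x hx w).1 hw).1
    · rintro rfl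
      exact ⟨y, .refl, hk, rfl⟩
  | succ k ih =>
    have hx0 : x c ≠ 0 := by omega
    obtain ⟨-, hp, hc, hF⟩ := h1 x hx hx0
    change _ ↔ y = F x
    rw [← hF]
    refine Iff.trans ?_ (ih _ hp (by omega))
    constructor
    · rintro ⟨z, hz, hz0, rfl⟩
      rcases Relation.ReflTransGen.cases_head hz with rfl | ⟨w, hw, hwz⟩
      · exact absurd hz0 hx0
      · obtain rfl := ((hstep x hx w).1 hw).2
        exact ⟨y, hwz, hz0, rfl⟩
    · rintro ⟨z, hz, hz0, rfl⟩
      exact ⟨y, .head ((hstep x hx _).2 ⟨hx0, rfl⟩) hz, hz0, rfl⟩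

theorem clear (a : ℕ) : RegFun p fun x => update x a 0 := by
  refine (loop (p := fun _ => True) (q := fun _ => True) a skip ?_ ?_).mono fun _ _ => trivial
  · intro x _ hx
    rw [← hx, update_eq_self]
  · intro x _ hx
    simp

theorem move {a b : ℕ} (hab : a ≠ b) : RegFun p fun x => update (update x b (x b + x a)) a 0 := by
  refine (loop (p := fun _ => True) (q := fun _ => True) a (inc b) ?_ ?_).mono fun _ _ => trivial
  · intro x _ hx
    funext j
    simp only [update_apply]
    grind
  · intro x _ hx
    refine ⟨trivial, trivial, by simp [hab], ?_⟩
    funext j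
    simp only [update_apply]
    grind

/-- Reading a register by decrements destroys it, so the loop fills both `b` and the empty scratch
register `s`; moving `s` back then restores `a`. -/
theorem copy {a b s : ℕ} (hab : a ≠ b) (has : a ≠ s) (hbs : b ≠ s) :
    RegFun (fun x => x s = 0) fun x => update x b (x b + x a) := by
  have h : RegFun (fun _ => True)
      fun x => update (update (update x b (x b + x a)) s (x s + x a)) a 0 := by
    refine loop a ((inc (p := fun _ => True) b).comp (inc (p := fun _ => True) s)
      fun _ _ => trivial) ?_ ?_
    · intro x _ hx
      funext j
      simp only [update_apply]
      grind
    · intro x _ hx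
      refine ⟨trivial, trivial, by simp [hab, has], ?_⟩
      funext j
      simp only [update_apply]
      grind
  refine (h.comp (move (p := fun _ => True) has.symm) fun _ _ => trivial).congr
    (fun _ _ => trivial) fun x hx => ?_
  funext j
  simp only [update_apply]
  grind

theorem clear_interval (b k : ℕ) :
    RegFun p fun x j => if b ≤ j ∧ j < b + k then 0 else x j := by
  induction k with
  | zero => exact skip.congr (fun _ => id) fun x _ => by funext j; grind
  | succ k ih =>
    refine (ih.comp (clear (p := fun _ => True) (b + k)) fun _ _ => trivial).congr
      (fun _ => id) fun x _ => ?_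
    funext j
    simp only [update_apply]
    grind

end RegFun

/-- The partial function `f` can be computed by register programs, for any choice of the registers
that hold the arguments and the result, with all registers from `base` on as work space. -/
def RegComputable {n : ℕ} (f : List.Vector ℕ n →. ℕ) : Prop :=
  ∀ (inp : Fin n → ℕ) (out base : ℕ), (∀ i, inp i < base ∧ inp i ≠ out) → out < base →
    RegImpl (fun x => x out = 0 ∧ ∀ j, base ≤ j → x j = 0)
      fun x y => ∃ v ∈ f (List.Vector.ofFn fun i => x (inp i)), y = Function.update x out v

/-! ### Partial recursive functions on registers -/

namespace RegComputable

open Function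

theorem regFun {n : ℕ} {f : List.Vector ℕ n → ℕ} (hf : RegComputable (f : List.Vector ℕ n →. ℕ))
    (inp : Fin n → ℕ) (out base : ℕ) (h : ∀ i, inp i < base ∧ inp i ≠ out) (ho : out < base) :
    RegFun (fun x => x out = 0 ∧ ∀ j, base ≤ j → x j = 0)
      fun x => update x out (f (List.Vector.ofFn fun i => x (inp i))) :=
  (hf inp out base h ho).congr (fun _ => id) fun x _ y => by simp

theorem of_regFun {n : ℕ} {f : List.Vector ℕ n → ℕ}
    (h : ∀ (inp : Fin n → ℕ) (out base : ℕ), (∀ i, inp i < base ∧ inp i ≠ out) → out < base →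
      RegFun (fun x => x out = 0 ∧ ∀ j, base ≤ j → x j = 0)
        fun x => update x out (f (List.Vector.ofFn fun i => x (inp i)))) :
    RegComputable (f : List.Vector ℕ n →. ℕ) :=
  fun inp out base hi ho => RegImpl.congr (h inp out base hi ho) (fun _ => id) fun x _ y => by simp

theorem zero : RegComputable (↑(fun _ : List.Vector ℕ 0 => 0) : List.Vector ℕ 0 →. ℕ) :=
  of_regFun fun inp out base _ _ => RegFun.skip.congr (fun _ => id) fun x hx => by
    rw [← hx.1, update_eq_self]

theorem get {n : ℕ} (i : Fin n) :
    RegComputable (↑(fun v : List.Vector ℕ n => v.get i) : List.Vector ℕ n →. ℕ) :=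
  of_regFun fun inp out base hi ho =>
    (RegFun.copy (hi i).2 (hi i).1.ne ho.ne).congr (fun x hx => hx.2 base le_rfl) fun x hx => by
      simp [hx.1]

theorem succ :
    RegComputable (↑(fun v : List.Vector ℕ 1 => v.head.succ) : List.Vector ℕ 1 →. ℕ) :=
  of_regFun fun inp out base hi ho =>
    (((get 0).regFun inp out base hi ho).comp (RegFun.inc (p := fun _ => True) out)
      fun _ _ => trivial).congr (fun _ => id) fun x hx => by
        simp [List.Vector.get_zero]

theorem mem_mOfFn {n : ℕ} (f : Fin n → Part ℕ) (v : List.Vector ℕ n) :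
    v ∈ List.Vector.mOfFn f ↔ ∀ i, v.get i ∈ f i := by
  induction n with
  | zero => simp [List.Vector.mOfFn, pure, eq_iff_true_of_subsingleton]
  | succ n ih =>
    rw [List.Vector.mOfFn]
    simp only [Part.bind_eq_bind, Part.mem_bind_iff, ih, pure, Part.mem_some_iff]
    constructor
    · rintro ⟨a, ha, w, hw, rfl⟩
      exact Fin.cases (by simpa using ha) (by simpa using hw)
    · intro h
      exact ⟨v.head, by simpa using h 0, v.tail, fun i => by simpa using h i.succ, by simp⟩

/-- The components are evaluated one after another, the `i`-th into register `base + i`, always with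
work space from `base + n` on, so that earlier results survive. -/
theorem pi {m n : ℕ} {g : Fin n → List.Vector ℕ m →. ℕ} (hg : ∀ i, RegComputable (g i))
    (inp : Fin m → ℕ) (base : ℕ) (hi : ∀ i, inp i < base) (k : ℕ) (hk : k ≤ n) :
    RegImpl (fun x => ∀ j, base ≤ j → x j = 0) fun x y => ∃ v : ℕ → ℕ,
      (∀ i : Fin n, (i : ℕ) < k → v i ∈ g i (List.Vector.ofFn fun i => x (inp i))) ∧
      y = fun j => if base ≤ j ∧ j < base + k then v (j - base) else x j := by
  induction k with
  | zero =>
    refine RegImpl.congr RegFun.skip (fun _ => id) fun x _ y => ?_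
    have : (fun j => if base ≤ j ∧ j < base + 0 then 0 else x j) = x := by funext j; grind
    constructor
    · rintro rfl
      exact ⟨0, by simp, by funext j; grind⟩
    · rintro ⟨v, -, rfl⟩
      funext j
      grind
  | succ k ih =>
    refine ((ih (by omega)).comp (hg ⟨k, hk⟩ inp (base + k) (base + n)
      (fun i => ⟨by have := hi i; omega, by have := hi i; omega⟩) (by omega)) ?_).congr
      (fun _ => id) fun x hx y => ?_
    · rintro x hx y ⟨v, -, rfl⟩
      refine ⟨by simp [hx], fun j hj => ?_⟩
      have := hx j (by omega)
      grind
    · have hinp : ∀ v : ℕ → ℕ, (List.Vector.ofFn fun i => (fun j =>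
          if base ≤ j ∧ j < base + k then v (j - base) else x j) (inp i)) =
          List.Vector.ofFn fun i => x (inp i) := by
        intro v
        congr 1
        funext i
        have := hi i
        grind
      constructor
      · rintro ⟨_, ⟨v, hv, rfl⟩, w, hw, rfl⟩
        rw [hinp] at hw
        refine ⟨update v k w, fun i hi' => ?_, ?_⟩
        · by_cases hik : (i : ℕ) = k
          · obtain rfl : i = ⟨k, hk⟩ := Fin.ext hik
            simpa using hw
          · rw [update_of_ne hik]
            exact hv i (by omega)
        · funext j
          simp only [update_apply]
          grind
      · rintro ⟨v, hv, rfl⟩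
        refine ⟨_, ⟨v, fun i hi => hv i (by omega), rfl⟩, v k, ?_, ?_⟩
        · rw [hinp]
          exact hv ⟨k, hk⟩ (Nat.lt_succ_self k)
        · funext j
          simp only [update_apply]
          grind

/-- The intermediate values sit in `n` registers from `base` on. They are cleared after `f` has read
them, since only `out` may change. -/
theorem comp {m n : ℕ} {f : List.Vector ℕ n →. ℕ} {g : Fin n → List.Vector ℕ m →. ℕ}
    (hf : RegComputable f) (hg : ∀ i, RegComputable (g i)) :
    RegComputable fun v => (List.Vector.mOfFn fun i => g i v) >>= f := by
  intro inp out base hi ho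
  have h1 : RegImpl (fun x => x out = 0 ∧ ∀ j, base ≤ j → x j = 0) fun x y => ∃ v : ℕ → ℕ,
      (∀ i : Fin n, (i : ℕ) < n → v i ∈ g i (List.Vector.ofFn fun i => x (inp i))) ∧
      y = fun j => if base ≤ j ∧ j < base + n then v (j - base) else x j :=
    (pi hg inp base (fun i => (hi i).1) n le_rfl).congr (fun x hx => hx.2) fun _ _ _ => Iff.rfl
  refine ((h1.comp
    (hf (fun i => base + i) out (base + n) (fun i => ⟨by omega, by omega⟩) (by omega)) ?_).comp
    (RegFun.clear_interval (p := fun _ => True) base n) fun _ _ _ _ => trivial).congr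
    (fun _ => id) fun x hx y => ?_
  · rintro x ⟨hx0, hx⟩ y ⟨v, -, rfl⟩
    refine ⟨by grind, fun j hj => ?_⟩
    have := hx j (by omega)
    grind
  · have hv : ∀ v : ℕ → ℕ, (List.Vector.ofFn fun i : Fin n => (fun j =>
        if base ≤ j ∧ j < base + n then v (j - base) else x j) (base + i)) =
        List.Vector.ofFn fun i : Fin n => v i := by
      intro v
      congr 1
      funext i
      simp
    constructor
    · rintro ⟨_, ⟨_, ⟨v, hv1, rfl⟩, w, hw, rfl⟩, rfl⟩
      rw [hv] at hw
      refine ⟨w, ?_, ?_⟩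
      · exact Part.mem_bind_iff.2 ⟨_, (mem_mOfFn _ _).2 fun i => by simpa using hv1 i i.2, hw⟩
      · funext j
        have := hx.2 j
        simp only [update_apply]
        grind
    · rintro ⟨w, hw, rfl⟩
      obtain ⟨u, hu, hw⟩ := Part.mem_bind_iff.1 hw
      rw [mem_mOfFn] at hu
      let v : ℕ → ℕ := fun i => if h : i < n then u.get ⟨i, h⟩ else 0
      have huv : (List.Vector.ofFn fun i : Fin n => v i) = u := by
        ext i
        simp [v]
      refine ⟨_, ⟨_, ⟨v, fun i _ => by simpa [v] using hu i, rfl⟩, w, ?_, rfl⟩, ?_⟩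
      · rwa [hv, huv]
      · funext j
        have := hx.2 j
        simp only [update_apply]
        grind

/-- Register `b` counts the remaining iterations, `b + 1` holds the current index, `b + 2` the
current value, `b + 3` receives the new value, and work space starts at `b + 4`. -/
theorem prec {n : ℕ} {f : List.Vector ℕ n → ℕ} {g : List.Vector ℕ (n + 2) → ℕ}
    (hf : RegComputable (f : List.Vector ℕ n →. ℕ))
    (hg : RegComputable (g : List.Vector ℕ (n + 2) →. ℕ)) :
    RegComputable (↑(fun v : List.Vector ℕ (n + 1) =>
      v.head.rec (f v.tail) fun y IH => g (y ::ᵥ IH ::ᵥ v.tail) : List.Vector ℕ (n + 1) → ℕ) :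
      List.Vector ℕ (n + 1) →. ℕ) := by
  refine of_regFun fun inp out b hi ho => ?_
  let args : (ℕ → ℕ) → List.Vector ℕ n := fun x => List.Vector.ofFn fun i => x (inp i.succ)
  let val : (ℕ → ℕ) → ℕ → ℕ := fun x k =>
    Nat.rec (f (args x)) (fun y IH => g (y ::ᵥ IH ::ᵥ args x)) k
  have hargs : ∀ x y : ℕ → ℕ, (∀ j < b, j ≠ out → x j = y j) → args x = args y := by
    intro x y h
    simp only [args]
    congr 1
    funext i
    exact h _ (hi _).1 (hi _).2
  have hval : ∀ x y : ℕ → ℕ, (∀ j < b, j ≠ out → x j = y j) → val x = val y := by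
    intro x y h
    simp only [val, hargs x y h]
  have hbody : RegFun (fun x => x (b + 3) = 0 ∧ ∀ j, b + 4 ≤ j → x j = 0) fun x =>
      update (update x (b + 2) (g (x (b + 1) ::ᵥ x (b + 2) ::ᵥ args x))) (b + 1)
        (x (b + 1) + 1) := by
    refine ((((hg.regFun (Fin.cons (b + 1) (Fin.cons (b + 2) fun i => inp i.succ)) (b + 3)
      (b + 4) (fun i => Fin.cases (by simp) (Fin.cases (by simp) fun i => by
        have := (hi i.succ).1; simp; omega) i) (by omega)).comp
      (RegFun.clear (p := fun _ => True) (b + 2)) fun _ _ => trivial).comp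
      (RegFun.move (p := fun _ => True) (a := b + 3) (b := b + 2) (by omega))
        fun _ _ => trivial).comp (RegFun.inc (p := fun _ => True) (b + 1))
        fun _ _ => trivial).congr (fun _ => id) fun x hx => ?_
    simp only [List.Vector.ofFn, Fin.cons_zero, Fin.cons_succ, args]
    funext j
    simp only [update_apply]
    grind
  -- The loop is specified from an arbitrary index, with the invariant that `b + 2` holds the value
  -- of the recursion there; only this form is inductive.
  have hloop : RegFun (fun x => (∀ j, b + 3 ≤ j → x j = 0) ∧ x (b + 2) = val x (x (b + 1)))
      fun x => update (update (update x b 0) (b + 1) (x (b + 1) + x b)) (b + 2)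
        (val x (x (b + 1) + x b)) := by
    refine RegFun.loop b hbody (fun x hx h0 => ?_) fun x hx h0 => ?_
    · rw [h0, add_zero, ← hx.2, ← h0]
      simp
    · have hlow : ∀ (y : ℕ → ℕ) (u v w : ℕ), val (update (update (update y b u) (b + 2) v)
          (b + 1) w) = val y := fun y u v w => hval _ _ fun j hj _ => by
        simp only [update_apply]
        grind
      have harg : args (update x b (x b - 1)) = args x := hargs _ _ fun j hj _ => by
        simp only [update_apply]
        grind
      refine ⟨⟨?_, fun j hj => ?_⟩, ⟨fun j hj => ?_, ?_⟩, by simp, ?_⟩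
      · rw [update_of_ne (by omega)]
        exact hx.1 _ le_rfl
      · rw [update_of_ne (by omega)]
        exact hx.1 _ (by omega)
      · rw [update_of_ne (by omega), update_of_ne (by omega), update_of_ne (by omega)]
        exact hx.1 _ hj
      · rw [hlow, harg]
        simp [val, ← hx.2]
      · rw [hlow]
        have h1 : x (b + 1) + 1 + (x b - 1) = x (b + 1) + x b := by omega
        simp [h1]
        funext j
        simp only [update_apply]
        grind
  have hinit : RegFun (fun x => x out = 0 ∧ ∀ j, b ≤ j → x j = 0)
      fun x => update (update x b (x (inp 0))) (b + 2) (val x 0) := by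
    have hcopy : RegFun (fun x => x out = 0 ∧ ∀ j, b ≤ j → x j = 0)
        fun x => update x b (x (inp 0)) :=
      (RegFun.copy (a := inp 0) (b := b) (s := b + 1) (hi 0).1.ne
        (by have := (hi 0).1; omega) (by omega)).congr (fun x hx => hx.2 _ (by omega))
        fun x hx => by rw [hx.2 b le_rfl, zero_add]
    refine (hcopy.comp (hf.regFun (fun i => inp i.succ) (b + 2) (b + 4)
      (fun i => by have := (hi i.succ).1; omega) (by omega)) fun x hx => ⟨?_, fun j hj => ?_⟩).congr
      (fun _ => id) fun x hx => ?_
    · rw [update_of_ne (by omega)]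
      exact hx.2 _ (by omega)
    · rw [update_of_ne (by omega)]
      exact hx.2 _ (by omega)
    · change update (update x b (x (inp 0))) (b + 2) (f (args (update x b (x (inp 0))))) =
        update (update x b (x (inp 0))) (b + 2) (f (args x))
      rw [hargs (update x b (x (inp 0))) x fun j hj _ => update_of_ne hj.ne _ _]
  refine (((hinit.comp hloop fun x hx => ⟨fun j hj => ?_, ?_⟩).comp
    (RegFun.move (p := fun _ => True) (a := b + 2) (b := out) (by omega)) fun _ _ => trivial).comp
    (RegFun.clear (p := fun _ => True) (b + 1)) fun _ _ => trivial).congr (fun _ => id)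
    fun x hx => ?_
  · rw [update_of_ne (by omega), update_of_ne (by omega)]
    exact hx.2 _ (by omega)
  · have h1 : val (update (update x b (x (inp 0))) (b + 2) (val x 0)) = val x :=
      hval _ _ fun j hj _ => by rw [update_of_ne (by omega), update_of_ne (by omega)]
    rw [h1, update_self, update_of_ne (by omega), update_of_ne (by omega), hx.2 _ (by omega)]
  · have h1 : val (update (update x b (x (inp 0))) (b + 2) (val x 0)) = val x :=
      hval _ _ fun j hj _ => by rw [update_of_ne (by omega), update_of_ne (by omega)]
    have h2 : (List.Vector.ofFn fun i => x (inp i)) = x (inp 0) ::ᵥ args x := by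
      simp [List.Vector.ofFn, args]
    have h3 := hx.2 (b + 1) (by omega)
    have h4 := hx.2 (b + 2) (by omega)
    have h5 := hx.2 b le_rfl
    simp only [h1, h2, List.Vector.head_cons, List.Vector.tail_cons]
    change _ = update x out (val x (x (inp 0)))
    funext j
    simp only [update_apply, h3]
    grind

/-- Register `b` holds the candidate and `b + 1` the value of `f` there. The iteration passes only
through candidates with nonzero value and must end in one with value zero, so a terminating run
finds the least zero, and there is none if the search diverges. -/
theorem rfind {n : ℕ} {f : List.Vector ℕ (n + 1) → ℕ}
    (hf : RegComputable (f : List.Vector ℕ (n + 1) →. ℕ)) :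
    RegComputable fun v : List.Vector ℕ n =>
      Nat.rfind fun k => (Part.some (decide (f (k ::ᵥ v) = 0)) : Part Bool) := by
  intro inp out b hi ho
  let val : (ℕ → ℕ) → ℕ → ℕ := fun x k => f (k ::ᵥ List.Vector.ofFn fun i => x (inp i))
  have hval : ∀ x y : ℕ → ℕ, (∀ j < b, x j = y j) → val x = val y := by
    intro x y h
    funext k
    simp only [val, h _ (hi _).1]
  have heval : RegFun (fun x => ∀ j, b + 1 ≤ j → x j = 0)
      fun x => update x (b + 1) (val x (x b)) := by
    refine (hf.regFun (Fin.cons b inp) (b + 1) (b + 2)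
      (fun i => Fin.cases (by simp) (fun i => by have := (hi i).1; simp; omega) i)
      (by omega)).congr (fun x hx => ⟨hx _ le_rfl, fun j hj => hx j (by omega)⟩) fun x hx => ?_
    simp [val, List.Vector.ofFn]
  -- The decrement of `b + 1` acts as the test that the value is nonzero.
  have hstep : RegImpl (fun x => ∀ j, b + 1 ≤ j → x j = 0)
      fun x y => val x (x b) ≠ 0 ∧ y = update x b (x b + 1) := by
    refine (((RegImpl.comp heval (RegImpl.of_rel (p := fun _ => True) (.dec (b + 1)))
      fun _ _ _ _ => trivial).comp (RegFun.clear (p := fun _ => True) (b + 1))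
      fun _ _ _ _ => trivial).comp (RegFun.inc (p := fun _ => True) b)
      fun _ _ _ _ => trivial).congr (fun _ => id) fun x hx y => ?_
    have h1 := hx (b + 1) le_rfl
    simp only [Relation.Comp]
    constructor
    · rintro ⟨_, ⟨_, ⟨_, rfl, h, rfl⟩, rfl⟩, rfl⟩
      refine ⟨by simpa using h, ?_⟩
      funext j
      simp only [update_apply]
      grind
    · rintro ⟨h, rfl⟩
      refine ⟨_, ⟨_, ⟨_, rfl, by simpa using h, rfl⟩, rfl⟩, ?_⟩
      funext j
      simp only [update_apply]
      grind
  have htest : RegImpl (fun x => ∀ j, b + 1 ≤ j → x j = 0)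
      fun x y => val x (x b) = 0 ∧ y = x := by
    refine (RegImpl.comp heval (RegImpl.of_rel (p := fun _ => True) (.test (b + 1)))
      fun _ _ _ _ => trivial).congr (fun _ => id) fun x hx y => ?_
    have h1 := hx (b + 1) le_rfl
    simp only [Relation.Comp]
    constructor
    · rintro ⟨_, rfl, h, rfl⟩
      have h : val x (x b) = 0 := by simpa using h
      refine ⟨h, ?_⟩
      rw [h, ← h1, update_eq_self]
    · rintro ⟨h, rfl⟩
      refine ⟨_, rfl, by simpa using h, ?_⟩
      rw [h, ← h1, update_eq_self]
  have hpre : ∀ x : ℕ → ℕ, (∀ j, b + 1 ≤ j → x j = 0) → ∀ y,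
      val x (x b) ≠ 0 ∧ y = update x b (x b + 1) → ∀ j, b + 1 ≤ j → y j = 0 := by
    rintro x hx y ⟨-, rfl⟩ j hj
    rw [update_of_ne (by omega)]
    exact hx j hj
  have hstar : ∀ x y : ℕ → ℕ,
      Relation.ReflTransGen (fun x y => val x (x b) ≠ 0 ∧ y = update x b (x b + 1)) x y ↔
        ∃ k, (∀ i < k, val x (x b + i) ≠ 0) ∧ y = update x b (x b + k) := by
    intro x y
    constructor
    · intro h
      induction h with
      | refl => exact ⟨0, by simp, by simp⟩
      | tail _ h ih =>
        obtain ⟨k, hk, rfl⟩ := ih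
        obtain ⟨h, rfl⟩ := h
        rw [hval _ x fun j hj => update_of_ne hj.ne _ _, update_self] at h
        refine ⟨k + 1, fun i hi => ?_, by simp [add_assoc]⟩
        obtain hi | rfl := Nat.lt_succ_iff_lt_or_eq.1 hi
        · exact hk i hi
        · exact h
    · rintro ⟨k, hk, rfl⟩
      induction k with
      | zero => simpa using Relation.ReflTransGen.refl
      | succ k ih =>
        refine (ih fun i hi => hk i (by omega)).tail ⟨?_, by simp [add_assoc]⟩
        rw [hval _ x fun j hj => update_of_ne hj.ne _ _, update_self]
        exact hk k (Nat.lt_succ_self k)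
  have hloop := (hstep.star hpre).comp htest fun x hx y hy j hj => by
    obtain ⟨k, -, rfl⟩ := (hstar x y).1 hy
    rw [update_of_ne (by omega)]
    exact hx j hj
  refine (hloop.comp (RegFun.move (p := fun _ => True) (a := b) (b := out) ho.ne')
    fun _ _ _ _ => trivial).congr (fun x hx j hj => hx.2 j (by omega)) fun x hx y => ?_
  have hb := hx.2 b le_rfl
  simp only [Relation.Comp, hstar]
  constructor
  · rintro ⟨_, ⟨_, ⟨k, hk, rfl⟩, h, rfl⟩, rfl⟩
    rw [hval _ x fun j hj => update_of_ne hj.ne _ _, update_self, hb, zero_add] at h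
    refine ⟨k, Nat.mem_rfind.2 ⟨by simpa [val] using h, fun {i} hi => ?_⟩, ?_⟩
    · simpa [val, hb] using hk i hi
    · funext j
      simp only [update_apply]
      grind
  · rintro ⟨k, hk, rfl⟩
    obtain ⟨h, hk⟩ := Nat.mem_rfind.1 hk
    refine ⟨_, ⟨_, ⟨k, fun i hi => ?_, rfl⟩, ?_, rfl⟩, ?_⟩
    · simpa [val, hb] using hk hi
    · rw [hval _ x fun j hj => update_of_ne hj.ne _ _, update_self, hb, zero_add]
      simpa [val] using h
    · funext j
      simp only [update_apply]
      grind

theorem of_primrec' {n : ℕ} {f : List.Vector ℕ n → ℕ} (hf : Nat.Primrec' f) :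
    RegComputable (f : List.Vector ℕ n →. ℕ) := by
  induction hf with
  | zero => exact zero
  | succ => exact succ
  | get i => exact get i
  | @comp m n f g _ _ hf hg =>
    have h := comp hf hg
    simp only [PFun.coe_val, Vector.mOfFn_part_some] at h
    have h' : (fun v => Part.some (List.Vector.ofFn fun i => g i v) >>= (f : _ →. ℕ)) =
        (↑(fun v => f (List.Vector.ofFn fun i => g i v) : List.Vector ℕ m → ℕ) : _ →. ℕ) :=
      funext fun v => Part.bind_some _ _
    rwa [h'] at h
  | prec _ _ hf hg => exact prec hf hg

theorem of_partrec' {n : ℕ} {f : List.Vector ℕ n →. ℕ} (hf : Nat.Partrec' f) :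
    RegComputable f := by
  induction hf with
  | prim hf => exact of_primrec' hf
  | comp g _ _ hf hg => exact comp hf hg
  | rfind _ hf => exact rfind hf

end RegComputable

/-! ### Two-counter programs -/

/-- Relations on the values of two counters that are defined by nondeterministic programs built
from additions of integer vectors and zero tests. -/
inductive IsCounterRel : ((Fin 2 → ℕ) → (Fin 2 → ℕ) → Prop) → Prop
  | add (z : Fin 2 → ℤ) : IsCounterRel fun u v => ∀ i, (v i : ℤ) = u i + z i
  | test (i : Fin 2) : IsCounterRel fun u v => u i = 0 ∧ v = u
  | comp {R S} : IsCounterRel R → IsCounterRel S → IsCounterRel (Relation.Comp R S)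
  | sup {R S} : IsCounterRel R → IsCounterRel S → IsCounterRel fun u v => R u v ∨ S u v
  | star {R} : IsCounterRel R → IsCounterRel (Relation.ReflTransGen R)

namespace IsCounterRel

/-- Repeatedly subtract `s` from counter `i` while adding `t` to the other one; the final zero test
forces the subtraction to come out even. -/
theorem exists_transfer (i : Fin 2) (s t : ℕ) : ∃ R, IsCounterRel R ∧
    ∀ u v, R u v ↔ ∃ k, u i = s * k ∧ v i = 0 ∧ ∀ l, l ≠ i → v l = u l + t * k := by
  refine ⟨_, (add fun l => if l = i then -(s : ℤ) else t).star.comp (test i), fun u v => ?_⟩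
  have key : ∀ v, Relation.ReflTransGen (fun u v : Fin 2 → ℕ => ∀ l,
      (v l : ℤ) = u l + if l = i then -(s : ℤ) else t) u v ↔
      ∃ k, v i + s * k = u i ∧ ∀ l, l ≠ i → v l = u l + t * k := by
    intro v
    constructor
    · intro h
      induction h with
      | refl => exact ⟨0, by simp⟩
      | tail _ h ih =>
        obtain ⟨k, hk, hk'⟩ := ih
        refine ⟨k + 1, ?_, fun l hl => ?_⟩
        · have := h i
          rw [if_pos rfl] at this
          rw [mul_add]
          omega
        · have := h l
          rw [if_neg hl, hk' l hl] at this
          rw [mul_add]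
          omega
    · rintro ⟨k, hk, hk'⟩
      induction k generalizing v with
      | zero =>
        have : v = u := by
          funext l
          by_cases hl : l = i
          · subst hl
            simpa using hk
          · simpa using hk' l hl
        rw [this]
      | succ k ih =>
        refine (ih (fun l => if l = i then v i + s else u l + t * k) ?_ fun l hl => ?_).tail
          fun l => ?_
        · simp only [if_true]
          rw [mul_add] at hk
          omega
        · simp [hl]
        · by_cases hl : l = i
          · subst hl
            simp
          · have := hk' l hl
            simp only [hl, if_false, this]
            push_cast
            ring
  constructor
  · rintro ⟨w, hw, h0, rfl⟩
    obtain ⟨k, hk, hk'⟩ := (key _).1 hw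
    exact ⟨k, by omega, h0, hk'⟩
  · rintro ⟨k, hk, h0, hk'⟩
    exact ⟨v, (key _).2 ⟨k, by omega, hk'⟩, h0, rfl⟩

end IsCounterRel

/-- Some two-counter program behaves as the relation `ρ` on the first counter when the second
counter is zero. -/
def CounterImpl (ρ : ℕ → ℕ → Prop) : Prop :=
  ∃ R, IsCounterRel R ∧ ∀ N v, R ![N, 0] v ↔ ∃ N', v = ![N', 0] ∧ ρ N N'

/-! ### Arithmetic on one counter with the help of the other -/

namespace CounterImpl

variable {ρ ρ' : ℕ → ℕ → Prop}

theorem congr (h : CounterImpl ρ) (h' : ∀ a b, ρ a b ↔ ρ' a b) : CounterImpl ρ' := by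
  obtain rfl : ρ = ρ' := funext fun a => funext fun b => propext (h' a b)
  exact h

theorem comp (h : CounterImpl ρ) (h' : CounterImpl ρ') : CounterImpl (Relation.Comp ρ ρ') := by
  obtain ⟨R, hR, h⟩ := h
  obtain ⟨S, hS, h'⟩ := h'
  refine ⟨_, hR.comp hS, fun N v => ?_⟩
  simp only [Relation.Comp, h]
  constructor
  · rintro ⟨_, ⟨N', rfl, h1⟩, h2⟩
    obtain ⟨N'', rfl, h3⟩ := (h' _ _).1 h2
    exact ⟨_, rfl, N', h1, h3⟩
  · rintro ⟨_, rfl, N', h1, h2⟩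
    exact ⟨_, ⟨N', rfl, h1⟩, (h' _ _).2 ⟨_, rfl, h2⟩⟩

theorem sup (h : CounterImpl ρ) (h' : CounterImpl ρ') :
    CounterImpl fun a b => ρ a b ∨ ρ' a b := by
  obtain ⟨R, hR, h⟩ := h
  obtain ⟨S, hS, h'⟩ := h'
  refine ⟨_, hR.sup hS, fun N v => ?_⟩
  simp only [h, h', and_or_left, exists_or]

theorem star (h : CounterImpl ρ) : CounterImpl (Relation.ReflTransGen ρ) := by
  obtain ⟨R, hR, h⟩ := h
  refine ⟨_, hR.star, fun N v => ⟨fun hr => ?_, ?_⟩⟩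
  · induction hr with
    | refl => exact ⟨N, rfl, .refl⟩
    | tail _ hs ih =>
      obtain ⟨N', rfl, h1⟩ := ih
      obtain ⟨N'', rfl, h2⟩ := (h _ _).1 hs
      exact ⟨_, rfl, h1.tail h2⟩
  · rintro ⟨N', rfl, hr⟩
    induction hr with
    | refl => exact .refl
    | tail _ hs ih => exact ih.tail ((h _ _).2 ⟨_, rfl, hs⟩)

/-- The number is transferred to the second counter at rate `t` per `s` and then moved back. This
multiplies by `t`, divides exactly by `s`, and for `s = t` tests divisibility. -/
theorem scale (s t : ℕ) : CounterImpl fun a b => ∃ k, a = s * k ∧ b = t * k := by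
  obtain ⟨R, hR, h⟩ := IsCounterRel.exists_transfer 0 s t
  obtain ⟨S, hS, h'⟩ := IsCounterRel.exists_transfer 1 1 1
  refine ⟨_, hR.comp hS, fun N v => ?_⟩
  simp only [Relation.Comp, h, h']
  constructor
  · rintro ⟨w, ⟨k, h1, h2, h3⟩, l, h4, h5, h6⟩
    have h7 := h3 1 (by simp)
    have h8 := h6 0 (by simp)
    simp only [Matrix.cons_val_zero, Matrix.cons_val_one, zero_add] at h1 h7
    refine ⟨t * k, ?_, k, h1, rfl⟩
    ext i
    fin_cases i
    · simp
      omega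
    · simpa using h5
  · rintro ⟨_, rfl, k, rfl, rfl⟩
    exact ⟨![0, t * k], ⟨k, by simp [Fin.forall_fin_two]⟩, t * k, by simp [Fin.forall_fin_two]⟩

theorem add (r : ℕ) : CounterImpl fun a b => b = a + r := by
  refine ⟨_, .add ![(r : ℤ), 0], fun N v => ?_⟩
  simp only [Fin.forall_fin_two]
  constructor
  · rintro ⟨h1, h2⟩
    simp at h1 h2
    refine ⟨N + r, ?_, rfl⟩
    ext i
    fin_cases i
    · simp
      omega
    · simpa using h2
  · rintro ⟨_, rfl, rfl⟩
    simp

theorem sub (r : ℕ) : CounterImpl fun a b => a = b + r := by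
  refine ⟨_, .add ![-(r : ℤ), 0], fun N v => ?_⟩
  simp only [Fin.forall_fin_two]
  constructor
  · rintro ⟨h1, h2⟩
    simp at h1 h2
    refine ⟨v 0, ?_, by omega⟩
    ext i
    fin_cases i
    · simp
    · simpa using h2
  · rintro ⟨_, rfl, rfl⟩
    simp

/-- The program guesses the nonzero remainder, subtracts it, checks divisibility by `p`, and adds it
back. The auxiliary statement lets the remainder range over `1, …, m`. -/
theorem not_dvd {p : ℕ} (hp : p ≠ 0) : CounterImpl fun a b => ¬ p ∣ a ∧ b = a := by
  have h : ∀ m, CounterImpl fun a b => ∃ r < m, (∃ k, a = p * k + (r + 1)) ∧ b = a := by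
    intro m
    induction m with
    | zero =>
      -- The empty relation is needed here: after adding one, `scale 0 0` would require the counter
      -- to be zero.
      refine ((add 1).comp (scale 0 0)).congr fun a b => ?_
      simp [Relation.Comp]
    | succ m ih =>
      refine (ih.sup (((sub (m + 1)).comp (scale p p)).comp (add (m + 1)))).congr fun a b => ?_
      simp only [Nat.lt_succ_iff_lt_or_eq, or_and_right, exists_or, exists_eq_left]
      refine or_congr_right ?_
      constructor
      · rintro ⟨_, ⟨_, rfl, k, rfl, rfl⟩, rfl⟩
        exact ⟨⟨k, rfl⟩, rfl⟩
      · rintro ⟨⟨k, rfl⟩, rfl⟩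
        exact ⟨_, ⟨_, rfl, k, rfl, rfl⟩, rfl⟩
  refine (h (p - 1)).congr fun a b => ?_
  constructor
  · rintro ⟨r, hr, ⟨k, rfl⟩, rfl⟩
    refine ⟨fun hd => ?_, rfl⟩
    have := Nat.le_of_dvd (Nat.succ_pos r) ((Nat.dvd_add_right (Dvd.intro k rfl)).1 hd)
    omega
  · rintro ⟨hd, rfl⟩
    have h0 : b % p ≠ 0 := fun h => hd (Nat.dvd_of_mod_eq_zero h)
    have h1 := Nat.mod_lt b (Nat.pos_of_ne_zero hp)
    have h2 := Nat.div_add_mod b p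
    exact ⟨b % p - 1, by omega, ⟨b / p, by omega⟩, rfl⟩

end CounterImpl

/-- The Gödel number of the contents of the first `m` registers. -/
noncomputable def godelNumber (m : ℕ) (x : ℕ → ℕ) : ℕ :=
  ∏ i ∈ Finset.range m, Nat.nth Nat.Prime i ^ x i

theorem godelNumber_update_succ {m i : ℕ} (hi : i < m) (x : ℕ → ℕ) :
    godelNumber m (Function.update x i (x i + 1)) = Nat.nth Nat.Prime i * godelNumber m x := by
  rw [godelNumber, godelNumber, ← Finset.mul_prod_erase _ _ (Finset.mem_range.2 hi),
    ← Finset.mul_prod_erase _ (fun i => Nat.nth Nat.Prime i ^ x i) (Finset.mem_range.2 hi),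
    Function.update_self, pow_succ', mul_assoc]
  congr 2
  refine Finset.prod_congr rfl fun j hj => ?_
  rw [Function.update_of_ne (Finset.ne_of_mem_erase hj)]

theorem nth_prime_dvd_godelNumber {m i : ℕ} (hi : i < m) (x : ℕ → ℕ) :
    Nat.nth Nat.Prime i ∣ godelNumber m x ↔ x i ≠ 0 := by
  constructor
  · intro h
    rw [godelNumber, Prime.dvd_finsetProd_iff (Nat.prime_nth_prime i).prime] at h
    obtain ⟨j, -, hj⟩ := h
    have h1 := (Nat.prime_dvd_prime_iff_eq (Nat.prime_nth_prime i) (Nat.prime_nth_prime j)).1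
      ((Nat.prime_nth_prime i).dvd_of_dvd_pow hj)
    obtain rfl := Nat.nth_injective Nat.infinite_setOfPred_prime h1
    intro h0
    rw [h0, pow_zero] at hj
    exact (Nat.prime_nth_prime i).one_lt.ne' (Nat.dvd_one.1 hj)
  · intro h
    exact (dvd_pow_self _ h).trans
      (Finset.dvd_prod_of_mem (fun i => Nat.nth Nat.Prime i ^ x i) (Finset.mem_range.2 hi))

/-- Register programs can be simulated on Gödel numbers by two-counter programs. -/
theorem IsRegisterRel.exists_counterImpl {R : (ℕ → ℕ) → (ℕ → ℕ) → Prop} (hR : IsRegisterRel R) :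
    ∃ m₀, ∀ m ≥ m₀, ∃ ρ, CounterImpl ρ ∧
      ∀ x N, ρ (godelNumber m x) N ↔ ∃ y, N = godelNumber m y ∧ R x y := by
  induction hR with
  | skip =>
    refine ⟨0, fun m _ => ⟨_, CounterImpl.add 0, fun x N => ?_⟩⟩
    simp
  | inc i =>
    refine ⟨i + 1, fun m hm => ⟨_, CounterImpl.scale 1 (Nat.nth Nat.Prime i), fun x N => ?_⟩⟩
    simp [godelNumber_update_succ (Nat.lt_of_succ_le hm)]
  | dec i =>
    refine ⟨i + 1, fun m hm => ⟨_, CounterImpl.scale (Nat.nth Nat.Prime i) 1, fun x N => ?_⟩⟩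
    have hi := Nat.lt_of_succ_le hm
    have h : x i ≠ 0 → godelNumber m x =
        Nat.nth Nat.Prime i * godelNumber m (Function.update x i (x i - 1)) := fun h => by
      rw [← godelNumber_update_succ hi, Function.update_self, Function.update_idem,
        Nat.sub_add_cancel (Nat.pos_of_ne_zero h), Function.update_eq_self]
    constructor
    · rintro ⟨k, hk, hN⟩
      have h0 := (nth_prime_dvd_godelNumber hi x).1 (Dvd.intro k hk.symm)
      refine ⟨_, ?_, h0, rfl⟩
      rw [h h0] at hk
      rw [hN, one_mul, Nat.eq_of_mul_eq_mul_left (Nat.prime_nth_prime i).pos hk]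
    · rintro ⟨_, rfl, h0, rfl⟩
      exact ⟨_, h h0, (one_mul _).symm⟩
  | test i =>
    refine ⟨i + 1, fun m hm =>
      ⟨_, CounterImpl.not_dvd (Nat.prime_nth_prime i).ne_zero, fun x N => ?_⟩⟩
    rw [nth_prime_dvd_godelNumber (Nat.lt_of_succ_le hm), not_not]
    constructor
    · rintro ⟨h, rfl⟩
      exact ⟨x, rfl, h, rfl⟩
    · rintro ⟨_, rfl, h, rfl⟩
      exact ⟨h, rfl⟩
  | comp _ _ ih1 ih2 =>
    obtain ⟨m1, h1⟩ := ih1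
    obtain ⟨m2, h2⟩ := ih2
    -- The statement holds for every sufficiently large `m` precisely so that both parts can share
    -- one encoding.
    refine ⟨max m1 m2, fun m hm => ?_⟩
    obtain ⟨ρ1, hρ1, h1⟩ := h1 m (le_of_max_le_left hm)
    obtain ⟨ρ2, hρ2, h2⟩ := h2 m (le_of_max_le_right hm)
    refine ⟨_, hρ1.comp hρ2, fun x N => ?_⟩
    simp only [Relation.Comp, h1]
    constructor
    · rintro ⟨_, ⟨y, rfl, hy⟩, hN⟩
      obtain ⟨z, rfl, hz⟩ := (h2 _ _).1 hN
      exact ⟨z, rfl, y, hy, hz⟩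
    · rintro ⟨z, rfl, y, hy, hz⟩
      exact ⟨_, ⟨y, rfl, hy⟩, (h2 _ _).2 ⟨z, rfl, hz⟩⟩
  | star _ ih =>
    obtain ⟨m1, h1⟩ := ih
    refine ⟨m1, fun m hm => ?_⟩
    obtain ⟨ρ, hρ, h⟩ := h1 m hm
    refine ⟨_, hρ.star, fun x N => ⟨fun hr => ?_, ?_⟩⟩
    · induction hr with
      | refl => exact ⟨x, rfl, .refl⟩
      | tail _ hs ih =>
        obtain ⟨y, rfl, hy⟩ := ih
        obtain ⟨z, rfl, hz⟩ := (h _ _).1 hs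
        exact ⟨z, rfl, hy.tail hz⟩
    · rintro ⟨y, rfl, hr⟩
      induction hr with
      | refl => exact .refl
      | tail _ hs ih => exact ih.tail ((h _ _).2 ⟨_, rfl, hs⟩)

/-- For every partial recursive function there is a two-counter program that terminates exactly on
the codes of the arguments in the domain. -/
theorem exists_isCounterRel_dom {f : ℕ →. ℕ} (hf : Partrec f) :
    ∃ R, IsCounterRel R ∧ ∀ n, (∃ v, R ![2 ^ n, 0] v) ↔ (f n).Dom := by
  obtain ⟨R, hR, h⟩ := RegComputable.of_partrec' (Nat.Partrec'.part_iff₁.2 hf) (fun _ => 0) 1 2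
    (by simp) (by simp)
  obtain ⟨m₀, hm⟩ := hR.exists_counterImpl
  -- Taking `m₀ + 1` guarantees that register `0`, which holds the input, is encoded. Its prime is
  -- `2`, whence the initial value `2 ^ n`.
  obtain ⟨ρ, ⟨S, hS, hρ⟩, hρR⟩ := hm (m₀ + 1) (Nat.le_succ m₀)
  refine ⟨S, hS, fun n => ?_⟩
  have hn : 2 ^ n = godelNumber (m₀ + 1) (Function.update 0 0 n) := by
    rw [godelNumber, Finset.prod_eq_single 0]
    · simp [Nat.nth_prime_zero_eq_two]
    · intro i _ hi
      simp [hi]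
    · simp
  have h' := h (Function.update 0 0 n) ⟨by simp, fun j hj => by
    rw [Function.update_of_ne (by omega)]; rfl⟩
  simp only [hρ, hn, hρR, h']
  simp [Part.dom_iff_mem]

/-! ### Finite graphs for two-counter programs -/

/-- The actions of two-counter programs: addition of a vector and zero tests. -/
inductive CounterAction
  | add (z : Fin 2 → ℤ)
  | test (i : Fin 2)

/-- The effect of an action on the values of the counters. -/
def CounterAction.Rel : CounterAction → (Fin 2 → ℕ) → (Fin 2 → ℕ) → Prop
  | add z, u, v => ∀ i, (v i : ℤ) = u i + z i
  | test i, u, v => u i = 0 ∧ v = u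

theorem CounterAction.rel_add_zero {u v : Fin 2 → ℕ} : (add 0).Rel u v ↔ u = v := by
  simp [Rel, funext_iff, eq_comm]

/-- The step relation of a graph whose edges are labelled by actions. -/
def CounterStep {Q : Type} (E : Set (Q × CounterAction × Q)) (a b : Q × (Fin 2 → ℕ)) : Prop :=
  ∃ α, (a.1, α, b.1) ∈ E ∧ α.Rel a.2 b.2

/-- Nondeterministic two-counter programs. -/
inductive CounterProgram
  | act (α : CounterAction)
  | comp (P Q : CounterProgram)
  | sup (P Q : CounterProgram)
  | star (P : CounterProgram)

namespace CounterProgram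

/-- The input-output relation of a program. -/
def Sem : CounterProgram → (Fin 2 → ℕ) → (Fin 2 → ℕ) → Prop
  | act α => α.Rel
  | comp P Q => Relation.Comp P.Sem Q.Sem
  | sup P Q => fun u v => P.Sem u v ∨ Q.Sem u v
  | star P => Relation.ReflTransGen P.Sem

/-- Relations carry no syntax; the nodes of the graph will be lists of program terms. -/
theorem exists_sem_eq {R : (Fin 2 → ℕ) → (Fin 2 → ℕ) → Prop} (hR : IsCounterRel R) :
    ∃ P : CounterProgram, P.Sem = R := by
  induction hR with
  | add z => exact ⟨act (.add z), rfl⟩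
  | test i => exact ⟨act (.test i), rfl⟩
  | comp _ _ h1 h2 =>
    obtain ⟨P, rfl⟩ := h1
    obtain ⟨Q, rfl⟩ := h2
    exact ⟨comp P Q, rfl⟩
  | sup _ _ h1 h2 =>
    obtain ⟨P, rfl⟩ := h1
    obtain ⟨Q, rfl⟩ := h2
    exact ⟨sup P Q, rfl⟩
  | star _ h =>
    obtain ⟨P, rfl⟩ := h
    exact ⟨star P, rfl⟩

/-- The relation of the sequential composition of a list of programs. -/
def SemList : List CounterProgram → (Fin 2 → ℕ) → (Fin 2 → ℕ) → Prop
  | [] => Eq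
  | P :: K => Relation.Comp P.Sem (SemList K)

/-- The edges of the graph on lists of programs that are still to be executed. -/
def edgesFrom : List CounterProgram → List (CounterAction × List CounterProgram)
  | [] => []
  | act α :: K => [(α, K)]
  | comp P Q :: K => [(.add 0, P :: Q :: K)]
  | sup P Q :: K => [(.add 0, P :: K), (.add 0, Q :: K)]
  | star P :: K => [(.add 0, K), (.add 0, P :: star P :: K)]

/-- The edges of the graph on lists of programs that are still to be executed. -/
def edges : Set (List CounterProgram × CounterAction × List CounterProgram) :=
  {e | e.2 ∈ edgesFrom e.1}

/-- Soundness of the graph: an edge executes or unfolds only the head of the list, so the relation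
of the remaining programs pulls back along it. -/
theorem semList_of_step {K L : List CounterProgram} {u v w : Fin 2 → ℕ}
    (h : CounterStep edges (K, u) (L, v)) (hL : SemList L v w) : SemList K u w := by
  obtain ⟨α, hα, hr⟩ := h
  simp only [edges, Set.mem_ofPred_eq] at hα hr
  match K with
  | [] => simp [edgesFrom] at hα
  | act β :: K =>
    simp only [edgesFrom, List.mem_singleton, Prod.mk.injEq] at hα
    obtain ⟨rfl, rfl⟩ := hα
    exact ⟨v, hr, hL⟩
  | comp P Q :: K =>
    simp only [edgesFrom, List.mem_singleton, Prod.mk.injEq] at hα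
    obtain ⟨rfl, rfl⟩ := hα
    obtain rfl := CounterAction.rel_add_zero.1 hr
    obtain ⟨x, hx, y, hy, h⟩ := hL
    exact ⟨y, ⟨x, hx, hy⟩, h⟩
  | sup P Q :: K =>
    simp only [edgesFrom, List.mem_cons, List.not_mem_nil, or_false, Prod.mk.injEq] at hα
    obtain ⟨rfl, rfl⟩ | ⟨rfl, rfl⟩ := hα <;> obtain rfl := CounterAction.rel_add_zero.1 hr <;>
      obtain ⟨x, hx, h⟩ := hL
    · exact ⟨x, Or.inl hx, h⟩
    · exact ⟨x, Or.inr hx, h⟩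
  | star P :: K =>
    simp only [edgesFrom, List.mem_cons, List.not_mem_nil, or_false, Prod.mk.injEq] at hα
    obtain ⟨rfl, rfl⟩ | ⟨rfl, rfl⟩ := hα <;> obtain rfl := CounterAction.rel_add_zero.1 hr
    · exact ⟨u, .refl, hL⟩
    · obtain ⟨x, hx, y, hy, h⟩ := hL
      exact ⟨y, .head hx hy, h⟩

theorem counterStep_add_zero {K L : List CounterProgram}
    (h : (CounterAction.add 0, L) ∈ edgesFrom K) (u : Fin 2 → ℕ) :
    CounterStep edges (K, u) (L, u) :=
  ⟨_, h, CounterAction.rel_add_zero.2 rfl⟩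

/-- Completeness of the graph. The arbitrary continuation `K` is what makes the induction work,
since subprograms run with a longer list behind them. -/
theorem reflTransGen_of_sem (P : CounterProgram) (K : List CounterProgram) {u v : Fin 2 → ℕ}
    (h : P.Sem u v) : Relation.ReflTransGen (CounterStep edges) (P :: K, u) (K, v) := by
  induction P generalizing K u v with
  | act α => exact .single ⟨α, by simp [edges, edgesFrom], h⟩
  | comp P Q ih1 ih2 =>
    obtain ⟨w, h1, h2⟩ := h
    exact .head (counterStep_add_zero (by simp [edgesFrom]) u) ((ih1 _ h1).trans (ih2 _ h2))
  | sup P Q ih1 ih2 =>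
    rcases h with h | h
    · exact .head (counterStep_add_zero (by simp [edgesFrom]) u) (ih1 _ h)
    · exact .head (counterStep_add_zero (by simp [edgesFrom]) u) (ih2 _ h)
  | star P ih =>
    induction h using Relation.ReflTransGen.head_induction_on with
    | refl => exact .single (counterStep_add_zero (by simp [edgesFrom]) v)
    | head h1 _ ih2 =>
      exact .head (counterStep_add_zero (by simp [edgesFrom]) _) ((ih _ h1).trans ih2)

theorem sem_iff_reflTransGen (P : CounterProgram) (u v : Fin 2 → ℕ) :
    P.Sem u v ↔ Relation.ReflTransGen (CounterStep edges) ([P], u) ([], v) := by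
  refine ⟨P.reflTransGen_of_sem [], fun h => ?_⟩
  suffices h : ∀ a, Relation.ReflTransGen (CounterStep edges) a ([], v) → SemList a.1 a.2 v by
    obtain ⟨w, hw, rfl⟩ := h _ ‹_›
    exact hw
  intro a h
  induction h using Relation.ReflTransGen.head_induction_on with
  | refl => rfl
  | head h _ ih => exact semList_of_step h ih

/-- The lists that occur in the execution of `P :: K` before `K` is reached. -/
def continuations : CounterProgram → List CounterProgram → Set (List CounterProgram)
  | act α, K => {act α :: K}
  | comp P Q, K => {comp P Q :: K} ∪ (P.continuations (Q :: K) ∪ Q.continuations K)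
  | sup P Q, K => {sup P Q :: K} ∪ (P.continuations K ∪ Q.continuations K)
  | star P, K => {star P :: K} ∪ P.continuations (star P :: K)

theorem finite_continuations (P : CounterProgram) (K : List CounterProgram) :
    (P.continuations K).Finite := by
  induction P generalizing K with
  | act α => exact Set.finite_singleton _
  | comp P Q ih1 ih2 => exact (Set.finite_singleton _).union ((ih1 _).union (ih2 _))
  | sup P Q ih1 ih2 => exact (Set.finite_singleton _).union ((ih1 _).union (ih2 _))
  | star P ih => exact (Set.finite_singleton _).union (ih _)

theorem cons_mem_continuations (P : CounterProgram) (K : List CounterProgram) :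
    P :: K ∈ P.continuations K := by
  cases P <;> simp [continuations]

/-- The set can be left only through `K`. The body of `star P` returns to `star P :: K`, which is
already in the set; hence unfolding iterations produces only finitely many lists. -/
theorem mem_continuations_of_edge {P : CounterProgram} {K L L' : List CounterProgram}
    {α : CounterAction} (hL : L ∈ P.continuations K) (h : (α, L') ∈ edgesFrom L) :
    L' ∈ P.continuations K ∨ L' = K := by
  induction P generalizing K with
  | act β =>
    obtain rfl : L = _ := hL
    simp only [edgesFrom, List.mem_singleton, Prod.mk.injEq] at h
    exact Or.inr h.2
  | comp P Q ih1 ih2 =>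
    obtain rfl | hL | hL := hL
    · simp only [edgesFrom, List.mem_singleton, Prod.mk.injEq] at h
      rw [h.2]
      exact Or.inl (Or.inr (Or.inl (cons_mem_continuations _ _)))
    · rcases ih1 hL with h | rfl
      · exact Or.inl (Or.inr (Or.inl h))
      · exact Or.inl (Or.inr (Or.inr (cons_mem_continuations _ _)))
    · exact (ih2 hL).imp_left fun h => Or.inr (Or.inr h)
  | sup P Q ih1 ih2 =>
    obtain rfl | hL | hL := hL
    · simp only [edgesFrom, List.mem_cons, List.not_mem_nil, or_false, Prod.mk.injEq] at h
      obtain ⟨-, rfl⟩ | ⟨-, rfl⟩ := h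
      · exact Or.inl (Or.inr (Or.inl (cons_mem_continuations _ _)))
      · exact Or.inl (Or.inr (Or.inr (cons_mem_continuations _ _)))
    · exact (ih1 hL).imp_left fun h => Or.inr (Or.inl h)
    · exact (ih2 hL).imp_left fun h => Or.inr (Or.inr h)
  | star P ih =>
    obtain rfl | hL := hL
    · simp only [edgesFrom, List.mem_cons, List.not_mem_nil, or_false, Prod.mk.injEq] at h
      obtain ⟨-, rfl⟩ | ⟨-, rfl⟩ := h
      · exact Or.inr rfl
      · exact Or.inl (Or.inr (cons_mem_continuations _ _))
    · rcases ih hL with h | rfl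
      · exact Or.inl (Or.inr h)
      · exact Or.inl (Or.inl rfl)

end CounterProgram

open CounterProgram in
/-- Every two-counter program is equivalent to a finite graph. -/
theorem IsCounterRel.exists_graph {R : (Fin 2 → ℕ) → (Fin 2 → ℕ) → Prop} (hR : IsCounterRel R) :
    ∃ (Q : Type) (_ : Finite Q) (E : Set (Q × CounterAction × Q)) (_ : E.Finite) (s t : Q),
      ∀ u v, R u v ↔ Relation.ReflTransGen (CounterStep E) (s, u) (t, v) := by
  obtain ⟨P, rfl⟩ := exists_sem_eq hR
  let N : Set (List CounterProgram) := insert [] (P.continuations [])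
  have hN : N.Finite := (P.finite_continuations []).insert []
  have hclosed : ∀ K ∈ N, ∀ α L, (α, L) ∈ edgesFrom K → L ∈ N := by
    rintro K (rfl | hK) α L h
    · simp [edgesFrom] at h
    · exact (mem_continuations_of_edge hK h).symm
  have : Finite N := hN
  let E : Set (N × CounterAction × N) := {e | (e.2.1, e.2.2.1) ∈ edgesFrom e.1.1}
  have hE : E.Finite := by
    have : (⋃ K : N, (fun a : CounterAction × List CounterProgram => (K.1, a.1, a.2)) ''
        {a | a ∈ edgesFrom K.1}).Finite :=
      Set.finite_iUnion fun K => (List.finite_toSet _).image _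
    refine (this.preimage (f := fun e : N × CounterAction × N => (e.1.1, e.2.1, e.2.2.1))
      (Function.Injective.injOn ?_)).subset fun e he => ?_
    · rintro ⟨⟨a, _⟩, α, b, _⟩ ⟨⟨a', _⟩, α', b', _⟩ h
      simpa using h
    · exact Set.mem_iUnion.2 ⟨e.1, _, he, rfl⟩
  refine ⟨N, this, E, hE, ⟨[P], Or.inr (P.cons_mem_continuations [])⟩, ⟨[], Or.inl rfl⟩,
    fun u v => (P.sem_iff_reflTransGen u v).trans ⟨fun h => ?_, fun h => ?_⟩⟩
  · suffices h : ∀ a, Relation.ReflTransGen (CounterStep edges) a ([], v) → ∀ ha : a.1 ∈ N,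
        Relation.ReflTransGen (CounterStep E) (⟨a.1, ha⟩, a.2) (⟨[], Or.inl rfl⟩, v) from
      h _ ‹_› _
    intro a h
    induction h using Relation.ReflTransGen.head_induction_on with
    | refl => exact fun _ => .refl
    | @head a b h _ ih =>
      intro ha
      obtain ⟨α, hα, hr⟩ := h
      have hb : b.1 ∈ N := hclosed _ ha _ _ hα
      have hs : CounterStep E ((⟨a.1, ha⟩ : N), a.2) ((⟨b.1, hb⟩ : N), b.2) := ⟨α, hα, hr⟩
      exact .head hs (ih hb)
  · exact h.lift (fun a : N × (Fin 2 → ℕ) => (a.1.1, a.2)) fun a b ⟨α, hα, hr⟩ => ⟨α, hα, hr⟩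

/-! ### From graphs to VASS-MDPs -/

/-- With unit weights, at most all transitions compete. The bound does not depend on the counters,
as a uniform `δ` requires. -/
theorem VASSMDP.inv_card_le_stepProb {d : ℕ} {Q : Type} {S : VASSMDP d Q} (hτ : ∀ x, S.τ x = 1)
    {c c' : VASSConfig d Q} (h : S.Step c c') : (S.T.card : ENNReal)⁻¹ ≤ S.stepProb c c' := by
  classical
  obtain ⟨r, hr, he, hf⟩ := h
  have hτ' : ∀ x, ((S.τ x : ℕ) : ENNReal) = 1 := fun x => by simp [hτ x]
  rw [VASSMDP.stepProb, ← one_div]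
  refine ENNReal.div_le_div ?_ ?_
  · rw [← hτ' ⟨r, hr⟩]
    exact Finset.single_le_sum_of_canonicallyOrdered
      (f := fun x => ((S.τ x : ℕ) : ENNReal)) (Finset.mem_filter.2 ⟨S.mem_enabled.2 he, hf⟩)
  · simp only [hτ', Finset.sum_const, nsmul_eq_mul, mul_one]
    exact_mod_cast (Finset.card_le_univ _).trans_eq (Fintype.card_coe _)

namespace CounterGraph

variable {Q : Type}

/-- The control states of the VASS-MDP for a graph: the nodes of the graph, states `(i, q)` in
which the claim that counter `i` is zero is checked before the play goes on in `q`, and a losing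
state. -/
abbrev Control (Q : Type) := Option (Q ⊕ Fin 2 × Q)

/-- The control state of a node. -/
abbrev node (q : Q) : Control Q := some (Sum.inl q)

/-- The control state that checks whether counter `i` is zero. -/
abbrev check (i : Fin 2) (q : Q) : Control Q := some (Sum.inr (i, q))

/-- The first transition in the simulation of an edge. -/
def edgeTransition : Q × CounterAction × Q → VASSTransition 2 (Control Q)
  | (q, .add z, q') => (node q, z, node q')
  | (q, .test i, q') => (node q, 0, check i q')

/-- The transitions of the VASS-MDP for the graph `E` with target `t`. -/
def transitions (E : Set (Q × CounterAction × Q)) (t : Q) : Set (VASSTransition 2 (Control Q)) :=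
  edgeTransition '' E ∪ ((Set.range fun p : Fin 2 × Q => (check p.1 p.2, 0, node p.2)) ∪
    ((Set.range fun p : Fin 2 × Q => (check p.1 p.2, -Pi.single p.1 1, none)) ∪
      {(node t, 0, node t)}))

theorem finite_transitions [Finite Q] {E : Set (Q × CounterAction × Q)} (hE : E.Finite) (t : Q) :
    (transitions E t).Finite :=
  (hE.image _).union ((Set.finite_range _).union ((Set.finite_range _).union
    (Set.finite_singleton _)))

theorem mem_transitions_node {E : Set (Q × CounterAction × Q)} {t q : Q} {z : Fin 2 → ℤ}
    {b : Control Q} : (node q, z, b) ∈ transitions E t ↔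
      (∃ q', (q, .add z, q') ∈ E ∧ b = node q') ∨
      (∃ i q', (q, .test i, q') ∈ E ∧ z = 0 ∧ b = check i q') ∨
      (q = t ∧ z = 0 ∧ b = node t) := by
  constructor
  · rintro (⟨⟨q₁, α | i, q₂⟩, he, h⟩ | ⟨p, h⟩ | ⟨p, h⟩ | h)
    · simp only [edgeTransition, Prod.mk.injEq, Option.some.injEq, Sum.inl.injEq] at h
      obtain ⟨rfl, rfl, rfl⟩ := h
      exact Or.inl ⟨q₂, he, rfl⟩
    · simp only [edgeTransition, Prod.mk.injEq, Option.some.injEq, Sum.inl.injEq] at h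
      obtain ⟨rfl, rfl, rfl⟩ := h
      exact Or.inr (Or.inl ⟨i, q₂, he, rfl, rfl⟩)
    · simp at h
    · simp at h
    · simp only [Set.mem_singleton_iff, Prod.mk.injEq, Option.some.injEq, Sum.inl.injEq] at h
      exact Or.inr (Or.inr h)
  · rintro (⟨q', h, rfl⟩ | ⟨i, q', h, rfl, rfl⟩ | ⟨rfl, rfl, rfl⟩)
    · exact Or.inl ⟨_, h, rfl⟩
    · exact Or.inl ⟨_, h, rfl⟩
    · exact Or.inr (Or.inr (Or.inr rfl))

theorem mem_transitions_check {E : Set (Q × CounterAction × Q)} {t q : Q} {i : Fin 2}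
    {z : Fin 2 → ℤ} {b : Control Q} : (check i q, z, b) ∈ transitions E t ↔
      (z = 0 ∧ b = node q) ∨ (z = -Pi.single i 1 ∧ b = none) := by
  constructor
  · rintro (⟨⟨q₁, α | i, q₂⟩, he, h⟩ | ⟨p, h⟩ | ⟨p, h⟩ | h)
    · simp [edgeTransition] at h
    · simp [edgeTransition] at h
    · simp only [Prod.mk.injEq, Option.some.injEq, Sum.inr.injEq] at h
      obtain ⟨⟨rfl, rfl⟩, rfl, rfl⟩ := h
      exact Or.inl ⟨rfl, rfl⟩
    · simp only [Prod.mk.injEq, Option.some.injEq, Sum.inr.injEq] at h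
      obtain ⟨⟨rfl, rfl⟩, rfl, rfl⟩ := h
      exact Or.inr ⟨rfl, rfl⟩
    · simp at h
  · rintro (⟨rfl, rfl⟩ | ⟨rfl, rfl⟩)
    · exact Or.inr (Or.inl ⟨(i, q), rfl⟩)
    · exact Or.inr (Or.inr (Or.inl ⟨(i, q), rfl⟩))

theorem not_mem_transitions_none {E : Set (Q × CounterAction × Q)} {t : Q} {z : Fin 2 → ℤ}
    {b : Control Q} : (none, z, b) ∉ transitions E t := by
  rintro (⟨⟨q₁, α | i, q₂⟩, he, h⟩ | ⟨p, h⟩ | ⟨p, h⟩ | h) <;> simp [edgeTransition] at h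

variable {k : ℕ} (e : Control Q ≃ Fin (k + 1)) (E : Set (Q × CounterAction × Q)) (t : Q)

/-- The VASS-MDP for the graph `E` with target `t`, with the control states numbered by `e`. -/
noncomputable def toVASSMDP (hT : (transitions E t).Finite) : VASSMDP 2 (Fin (k + 1)) where
  Q1 := {x | ∃ q, x = e (node q)}
  T := (hT.image fun r => (e r.1, r.2.1, e r.2.2)).toFinset
  τ _ := 1

variable {e E t} (hT : (transitions E t).Finite)

/-- Enabledness is the solvability of `v = u + z` in natural numbers; this form avoids truncation.
-/
theorem toVASSMDP_step_iff {a : Control Q} {u : Fin 2 → ℕ} {c : VASSConfig 2 (Fin (k + 1))} :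
    (toVASSMDP e E t hT).toMDP.Step (e a, u) c ↔
      ∃ z b v, (a, z, b) ∈ transitions E t ∧ (∀ i, (v i : ℤ) = u i + z i) ∧ c = (e b, v) := by
  constructor
  · rintro ⟨r, hr, ⟨h1, h2⟩, rfl⟩
    simp only [toVASSMDP, Set.Finite.mem_toFinset, Set.mem_image] at hr
    obtain ⟨⟨a', z, b⟩, hr, rfl⟩ := hr
    obtain rfl := e.injective h1
    exact ⟨z, b, _, hr, fun i => Int.toNat_of_nonneg (h2 i), rfl⟩
  · rintro ⟨z, b, v, hr, hv, rfl⟩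
    refine ⟨(e a, z, e b), ?_, ⟨rfl, fun i => ?_⟩, ?_⟩
    · simp only [toVASSMDP, Set.Finite.mem_toFinset, Set.mem_image]
      exact ⟨_, hr, rfl⟩
    · simp only
      rw [← hv i]
      exact Int.natCast_nonneg _
    · simp only [VASSMDP.fire, Prod.mk.injEq, true_and]
      funext i
      rw [← hv i, Int.toNat_natCast]

theorem node_mem_player1 (q : Q) (u : Fin 2 → ℕ) :
    (e (node q), u) ∈ (toVASSMDP e E t hT).toMDP.player1 := ⟨q, rfl⟩

theorem check_not_mem_player1 (i : Fin 2) (q : Q) (u : Fin 2 → ℕ) :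
    (e (check i q), u) ∉ (toVASSMDP e E t hT).toMDP.player1 := by
  rintro ⟨q', h⟩
  simpa using e.injective h

/-- The steps in which the other player has no choice. -/
def SafeStep {C : Type} (M : MDP C) (c c' : C) : Prop :=
  M.Step c c' ∧ (c ∉ M.player1 → ∀ b, M.Step c b → b = c')

/-- Strategies are built from infinite paths, so the finite path is prolonged by looping at its end.
-/
theorem exists_path_of_reflTransGen {α : Type} {r : α → α → Prop} {a b : α}
    (h : Relation.ReflTransGen r a b) (hb : r b b) :
    ∃ w : ℕ → α, w 0 = a ∧ (∀ n, r (w n) (w (n + 1))) ∧ ∃ N, ∀ n ≥ N, w n = b := by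
  induction h using Relation.ReflTransGen.head_induction_on with
  | refl => exact ⟨fun _ => b, rfl, fun _ => hb, 0, fun _ _ => rfl⟩
  | @head a c h _ ih =>
    obtain ⟨w, rfl, hw, N, hN⟩ := ih
    refine ⟨fun n => Nat.casesOn n a w, rfl, fun n => ?_, N + 1, fun n hn => ?_⟩
    · cases n with
      | zero => exact h
      | succ n => exact hw n
    · cases n with
      | zero => omega
      | succ n => exact hN n (by omega)

/-- Every step of the computation becomes one or two steps without a choice for the opponent: nodes
belong to Player 1, and at a true zero claim the decrement is disabled. -/
theorem surely_of_reflTransGen {s : Q} {u v : Fin 2 → ℕ}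
    (h : Relation.ReflTransGen (CounterStep E) (s, u) (t, v)) :
    (toVASSMDP e E t hT).toMDP.Surely (e (node s), u)
      (MDP.repeatedReach {c | c.1 = e (node t)}) := by
  set M := (toVASSMDP e E t hT).toMDP
  have hstep : ∀ a b, CounterStep E a b →
      Relation.ReflTransGen (SafeStep M) (e (node a.1), a.2) (e (node b.1), b.2) := by
    rintro ⟨q, x⟩ ⟨q', y⟩ ⟨z | i, hα, hr⟩
    · refine .single ⟨(toVASSMDP_step_iff hT).2 ⟨z, node q', y, ?_, hr, rfl⟩,
        fun h => absurd (node_mem_player1 hT q x) h⟩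
      exact mem_transitions_node.2 (Or.inl ⟨q', hα, rfl⟩)
    · obtain ⟨hx, rfl⟩ : x i = 0 ∧ y = x := hr
      refine .head (b := (e (check i q'), y))
        ⟨(toVASSMDP_step_iff hT).2 ⟨0, check i q', y, ?_, by simp, rfl⟩,
        fun h => absurd (node_mem_player1 hT q y) h⟩
        (.single ⟨(toVASSMDP_step_iff hT).2 ⟨0, node q', y, ?_, by simp, rfl⟩, fun _ b hb => ?_⟩)
      · exact mem_transitions_node.2 (Or.inr (Or.inl ⟨i, q', hα, rfl, rfl⟩))
      · exact mem_transitions_check.2 (Or.inl ⟨rfl, rfl⟩)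
      · obtain ⟨z, b, w, hz, hw, rfl⟩ := (toVASSMDP_step_iff hT).1 hb
        obtain ⟨rfl, rfl⟩ | ⟨rfl, rfl⟩ := mem_transitions_check.1 hz
        · have : w = y := by
            funext j
            simpa using hw j
          rw [this]
        · have := hw i
          simp [hx] at this
  have hpath : Relation.ReflTransGen (SafeStep M) (e (node s), u) (e (node t), v) :=
    h.lift' (fun a : Q × (Fin 2 → ℕ) => (e (node a.1), a.2)) hstep
  have hloop : SafeStep M (e (node t), v) (e (node t), v) :=
    ⟨(toVASSMDP_step_iff hT).2 ⟨0, node t, v,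
      mem_transitions_node.2 (Or.inr (Or.inr ⟨rfl, rfl, rfl⟩)), by simp, rfl⟩,
      fun h => absurd (node_mem_player1 hT t v) h⟩
  obtain ⟨w, hw0, hw, N, hN⟩ := exists_path_of_reflTransGen hpath hloop
  obtain ⟨σ, hσ⟩ := MDP.exists_strategy_plays_subset w (fun n => (hw n).1) fun n => (hw n).2
  refine ⟨σ, fun ω hω => ?_⟩
  rw [← hw0] at hω
  obtain rfl : ω = _ := hσ hω
  exact fun m => ⟨max m N, le_max_left _ _, _, by simp [hN _ (le_max_right m N)], rfl⟩

/-- If no computation leads to `t`, faithful simulation never meets the target, so a false claim is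
unavoidable on the way and costs probability `δ`. -/
theorem exists_reflTransGen_of_limitSurely {s : Q} {u : Fin 2 → ℕ}
    (h : (toVASSMDP e E t hT).toMDP.LimitSurely (e (node s), u)
      (MDP.reach {c | c.1 = e (node t)})) :
    ∃ v, Relation.ReflTransGen (CounterStep E) (s, u) (t, v) := by
  by_contra hno
  set M := (toVASSMDP e E t hT).toMDP
  let good : Set (VASSConfig 2 (Fin (k + 1))) := {c |
    (∃ q, c.1 = e (node q) ∧ Relation.ReflTransGen (CounterStep E) (s, u) (q, c.2)) ∨
    -- Checks of true claims count as faithful simulation: their only successor is the node `q` with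
    -- the same counters.
    (∃ i q, c.1 = e (check i q) ∧ c.2 i = 0 ∧
      Relation.ReflTransGen (CounterStep E) (s, u) (q, c.2))}
  let bad : Set (VASSConfig 2 (Fin (k + 1))) := {c | ∃ i q, c.1 = e (check i q) ∧ c.2 i ≠ 0}
  let trap : Set (VASSConfig 2 (Fin (k + 1))) := {c | c.1 = e none}
  let δ : ENNReal := ((toVASSMDP e E t hT).T.card : ENNReal)⁻¹
  have hle : ∀ σ : M.Strategy, MDP.playMeasure σ (e (node s), u)
      (MDP.reach {c | c.1 = e (node t)}) ≤ 1 - δ := by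
    intro σ
    refine MDP.playMeasure_reach_le (good := good) (bad := bad) (trap := trap)
      ?_ ?_ ?_ ?_ ?_ ?_ ?_ σ (Or.inl ⟨s, rfl, .refl⟩)
    · rintro ⟨_, x⟩ (⟨q, rfl, hq⟩ | ⟨i, q, rfl, hx, hq⟩) c hc
      · obtain ⟨z, b, y, hz, hy, rfl⟩ := (toVASSMDP_step_iff hT).1 hc
        obtain ⟨q', h, rfl⟩ | ⟨i, q', h, rfl, rfl⟩ | ⟨rfl, rfl, rfl⟩ := mem_transitions_node.1 hz
        · exact Or.inl (Or.inl ⟨q', rfl, hq.tail ⟨_, h, hy⟩⟩)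
        · obtain rfl : x = y := CounterAction.rel_add_zero.1 hy
          by_cases hx : x i = 0
          · exact Or.inl (Or.inr ⟨i, q', rfl, hx, hq.tail ⟨_, h, hx, rfl⟩⟩)
          · exact Or.inr ⟨i, q', rfl, hx⟩
        · obtain rfl : x = y := CounterAction.rel_add_zero.1 hy
          exact Or.inl (Or.inl ⟨q, rfl, hq⟩)
      · obtain ⟨z, b, y, hz, hy, rfl⟩ := (toVASSMDP_step_iff hT).1 hc
        obtain ⟨rfl, rfl⟩ | ⟨rfl, rfl⟩ := mem_transitions_check.1 hz
        · obtain rfl : x = y := CounterAction.rel_add_zero.1 hy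
          exact Or.inl (Or.inl ⟨q, rfl, hq⟩)
        · have := hy i
          simp only at hx
          simp [hx] at this
    · rintro ⟨_, x⟩ ⟨i, q, rfl, hx⟩
      -- The claim is false, so the decrement is enabled and leads to the losing state.
      have hs : M.Step (e (check i q), x) (e none, fun j => if j = i then x j - 1 else x j) := by
        refine (toVASSMDP_step_iff hT).2 ⟨-Pi.single i 1, none, _,
          mem_transitions_check.2 (Or.inr ⟨rfl, rfl⟩), fun j => ?_, rfl⟩
        by_cases hj : j = i
        · subst hj
          simp only at hx
          simp
          omega
        · simp [hj]
      exact ⟨⟨check_not_mem_player1 hT i q x, _, hs⟩, _, rfl, VASSMDP.inv_card_le_stepProb (fun _ => rfl) hs⟩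
    · rintro ⟨_, x⟩ rfl ⟨c, hc⟩
      obtain ⟨z, b, y, hz, -⟩ := (toVASSMDP_step_iff hT).1 hc
      exact not_mem_transitions_none hz
    · refine Set.disjoint_left.2 ?_
      rintro ⟨_, x⟩ (⟨q, rfl, -⟩ | ⟨i, q, rfl, hx, -⟩) ⟨j, q', h, hx'⟩
      · simpa using e.injective h
      · obtain ⟨rfl, -⟩ : i = j ∧ q = q' := by simpa using e.injective h
        exact hx' hx
    -- This is where the absence of a computation reaching `t` enters.
    · refine Set.disjoint_left.2 ?_
      rintro ⟨_, x⟩ (⟨q, rfl, hq⟩ | ⟨i, q, rfl, -⟩) h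
      · obtain rfl : q = t := by simpa using e.injective h
        exact hno ⟨x, hq⟩
      · simpa using e.injective h
    · refine Set.disjoint_left.2 ?_
      rintro ⟨_, x⟩ ⟨i, q, rfl, -⟩ h
      simpa using e.injective h
    · refine Set.disjoint_left.2 ?_
      rintro ⟨_, x⟩ rfl h
      simpa using e.injective h
  have hδ : δ ≠ 0 := ENNReal.inv_ne_zero.2 (ENNReal.natCast_ne_top _)
  have hlt : 1 - δ < 1 := ENNReal.sub_lt_self ENNReal.one_ne_top one_ne_zero hδ
  exact absurd (h.symm.le.trans (iSup_le hle)) (not_le.2 hlt)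

end CounterGraph

/-- For every partial recursive function there is a code of a two-dimensional VASS-MDP such that,
started with counter values `(2 ^ n, 0)`, the reachability problems are equivalent to membership
of `n` in the domain. -/
theorem exists_vassCode {f : ℕ →. ℕ} (hf : Partrec f) :
    ∃ (k : ℕ) (O : List Bool) (L : List ((ℕ × List ℤ × ℕ) × ℕ)) (q t : ℕ), ∀ n,
      ((f n).Dom → (VASSCode.decode 2 (k, O, L, (q, [2 ^ n, 0]), t)).SureRepeatedReachability) ∧
      ((VASSCode.decode 2 (k, O, L, (q, [2 ^ n, 0]), t)).LimitSureReachability → (f n).Dom) := by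
  obtain ⟨R, hR, h⟩ := exists_isCounterRel_dom hf
  obtain ⟨Q, hQ, E, hE, s, t, hG⟩ := hR.exists_graph
  obtain ⟨m, ⟨e⟩⟩ := Finite.exists_equiv_fin (CounterGraph.Control Q)
  obtain ⟨k, rfl⟩ : ∃ k, m = k + 1 := Nat.exists_eq_succ_of_ne_zero (e none).pos.ne'
  have hT := CounterGraph.finite_transitions hE t
  obtain ⟨⟨k', O, L, ⟨q, w⟩, g⟩, hdec⟩ := VASSCode.decode_surjective 2
    ⟨k, CounterGraph.toVASSMDP e E t hT, (e (CounterGraph.node s), 0), e (CounterGraph.node t)⟩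
  refine ⟨k', O, L, q, g, fun n => ?_⟩
  have hn : VASSCode.decode 2 (k', O, L, (q, [2 ^ n, 0]), g) =
      ⟨k, CounterGraph.toVASSMDP e E t hT, (e (CounterGraph.node s), ![2 ^ n, 0]),
        e (CounterGraph.node t)⟩ := by
    have hv : (fun i : Fin 2 => [2 ^ n, 0].getD i 0) = ![2 ^ n, 0] := by
      funext i
      fin_cases i <;> rfl
    simp only [VASSCode.decode, VASSInput.mk.injEq] at hdec ⊢
    obtain ⟨rfl, h1, h2, h3⟩ := hdec
    simp only [heq_eq_eq, Prod.mk.injEq] at h1 h2 h3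
    simp only [h1, h2.1, h3, hv, heq_eq_eq, and_self]
  rw [hn, ← h n]
  simp only [hG]
  exact ⟨fun ⟨v, hv⟩ => CounterGraph.surely_of_reflTransGen hT hv,
    CounterGraph.exists_reflTransGen_of_limitSurely hT⟩

/-! ### Reduction from the halting problem -/

/-- Any property between the two extremes holds for the constructed instance exactly when the
program halts, so it inherits the undecidability of halting. -/
theorem undecidableInDim_two {P : VASSInput 2 → Prop}
    (h1 : ∀ I, I.SureRepeatedReachability → P I) (h2 : ∀ I, P I → I.LimitSureReachability) :
    UndecidableInDim 2 P := by
  intro hP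
  -- A universal function: `n` is in its domain iff the `n`-th program halts on input `0`. A single
  -- VASS-MDP therefore handles all programs.
  have hf : Partrec fun n : ℕ => (Denumerable.ofNat Nat.Partrec.Code n).eval 0 :=
    Nat.Partrec.Code.eval_part.comp (Computable.ofNat _) (Computable.const 0)
  obtain ⟨k, O, L, q, t, h⟩ := exists_vassCode hf
  refine ComputablePred.halting_problem 0 ?_
  have hpow : Primrec fun n : ℕ => 2 ^ n :=
    (Primrec₂.unpaired'.1 Nat.Primrec.pow).comp (Primrec.const 2) Primrec.id
  have hcode : Computable fun c : Nat.Partrec.Code =>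
      ((k, O, L, (q, [2 ^ Encodable.encode c, 0]), t) : VASSCode) := by
    refine Primrec.to_comp (.pair (.const _) (.pair (.const _) (.pair (.const _)
      (.pair (.pair (.const _) (Primrec.list_cons.comp (hpow.comp Primrec.encode) (.const _)))
        (.const _)))))
  refine ComputablePred.computable_of_manyOneReducible ⟨_, hcode, fun c => ?_⟩ hP
  have := h (Encodable.encode c)
  simp only [Denumerable.ofNat_encode] at this
  exact ⟨fun hc => h1 _ (this.1 hc), fun hc => this.2 (h2 _ hc)⟩

theorem undecidableVASSProblem_of_undecidableInDim (d : ℕ) {P : ∀ d, VASSInput d → Prop}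
    (h : UndecidableInDim d (P d)) : UndecidableVASSProblem P := fun hP =>
  h (ComputablePred.computable_of_manyOneReducible
    ⟨fun c => (d, c), Computable.pair (Computable.const d) Computable.id, fun _ => Iff.rfl⟩ hP)

theorem mainTheorem8 :
    (UndecidableVASSProblem (fun d => VASSInput.SureReachability (d := d)) ∧
      UndecidableVASSProblem (fun d => VASSInput.AlmostSureReachability (d := d)) ∧
      UndecidableVASSProblem (fun d => VASSInput.LimitSureReachability (d := d)) ∧
      UndecidableVASSProblem (fun d => VASSInput.SureRepeatedReachability (d := d)) ∧
      UndecidableVASSProblem (fun d => VASSInput.AlmostSureRepeatedReachability (d := d)) ∧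
      UndecidableVASSProblem (fun d => VASSInput.LimitSureRepeatedReachability (d := d))) ∧
    (UndecidableInDim 2 VASSInput.SureReachability ∧
      UndecidableInDim 2 VASSInput.AlmostSureReachability ∧
      UndecidableInDim 2 VASSInput.LimitSureReachability ∧
      UndecidableInDim 2 VASSInput.SureRepeatedReachability ∧
      UndecidableInDim 2 VASSInput.AlmostSureRepeatedReachability ∧
      UndecidableInDim 2 VASSInput.LimitSureRepeatedReachability) := by
  have hsub : ∀ I : VASSInput 2, MDP.repeatedReach I.targetSet ⊆ MDP.reach I.targetSet :=
    fun I => MDP.repeatedReach_subset_reach _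
  have h1 : UndecidableInDim 2 VASSInput.SureReachability :=
    undecidableInDim_two (fun I h => MDP.Surely.mono (hsub I) h)
      fun _ h => (MDP.Surely.almostSurely h).limitSurely
  have h2 : UndecidableInDim 2 VASSInput.AlmostSureReachability :=
    undecidableInDim_two (fun I h => (MDP.Surely.mono (hsub I) h).almostSurely)
      fun _ h => MDP.AlmostSurely.limitSurely h
  have h3 : UndecidableInDim 2 VASSInput.LimitSureReachability :=
    undecidableInDim_two (fun I h => (MDP.Surely.mono (hsub I) h).almostSurely.limitSurely)
      fun _ h => h
  have h4 : UndecidableInDim 2 VASSInput.SureRepeatedReachability :=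
    undecidableInDim_two (fun _ h => h)
      fun I h => (MDP.Surely.mono (hsub I) h).almostSurely.limitSurely
  have h5 : UndecidableInDim 2 VASSInput.AlmostSureRepeatedReachability :=
    undecidableInDim_two (fun _ h => MDP.Surely.almostSurely h)
      fun I h => (MDP.AlmostSurely.limitSurely h).mono (hsub I)
  have h6 : UndecidableInDim 2 VASSInput.LimitSureRepeatedReachability :=
    undecidableInDim_two (fun _ h => (MDP.Surely.almostSurely h).limitSurely)
      fun I h => MDP.LimitSurely.mono (hsub I) h
  exact ⟨⟨undecidableVASSProblem_of_undecidableInDim 2 h1,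
    undecidableVASSProblem_of_undecidableInDim 2 h2,
    undecidableVASSProblem_of_undecidableInDim 2 h3,
    undecidableVASSProblem_of_undecidableInDim 2 h4,
    undecidableVASSProblem_of_undecidableInDim 2 h5,
    undecidableVASSProblem_of_undecidableInDim 2 h6⟩, h1, h2, h3, h4, h5, h6⟩
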